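/- **Setting.** All categories are $\mathbb C$-linear with finite-dimensional morphism spaces. Let $\mathcal C$ be a spherical fusion category and $\mathcal D$ a modular category, that is, a ribbon fusion category in which every transparent simple object is isomorphic to the unit $I$. Let $F\colon\mathcal C\to\mathcal D$ be a linear pivotal (strong monoidal, pivotal-structure preserving) functor. $\Lambda_{\mathcal C}$, $\Lambda_{\mathcal D}$ are sets of representatives of the simple objects, $d(X)$ is the dimension of an object, $\Omega_{\mathcal C}=\sum_{X\in\Lambda_{\mathcal C}}d(X)\,X$ is the Kirby colour, $\dim\Omega_{\mathcal C}=\sum_{X\in\Lambda_{\mathcal C}} d(X)^2$ (similarly for $\mathcal D$), $F\Omega_{\mathcal C}=\sum_X d(X)\,FX$, and $(F\Omega_{\mathcal C})'$ is its transparent part, obtained by decomposing into simple objects of $\mathcal D$ and keeping only the transparent ones. Let $n=\sum_{X\in\Lambda_{\mathcal C}}d(X)\dim_{\mathbb C}\mathcal D(FX,I)$ be the multiplicity of $I$ in $F\Omega_{\mathcal C}$. **Diagrams.** Let $K$ be a Kirby diagram with $h_1$ 1-handles and $h_2$ 2-handles (for instance, of a handle decomposition with one 0-handle of a smooth, closed,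 oriented four-manifold $M$): a planar diagram (blackboard framing) of a pair of 3-balls, marked $+$ and $-$, for each 1-handle, and of the oriented attaching circles of the 2-handles, which run through the 1-handles; the strands that enter or leave the $+$-ball of a 1-handle continue in the same order at its $-$-ball. Let $L$ be a framed link diagram obtained from $K$ by passing to dotted circle notation: after an isotopy that puts the two balls of every 1-handle opposite to each other, each pair of balls is replaced by a $0$-framed dotted circle, through which the strands are continued; $L$ itself is taken up to isotopy. **The invariant.** The generalised dichromatic invariant of $L$ is $$I_F(L)=\frac{\langle L(\Omega_{\mathcal D},F\Omega_{\mathcal C})\rangle}{(\dim\Omega_{\mathcal C})^{h_2-h_1}\,\bigl(\dim\Omega_{\mathcal D}\cdot\dim (F\Omega_{\mathcal C})'\bigr)^{h_1}},$$ where $\langle L(\Omega_{\mathcal D},F\Omega_{\mathcal C})\rangle$ is the value in $\mathcal D(I,I)\cong\mathbb C$ of the link with all dotted components coloured by $\Omega_{\mathcal D}$ and all others by $F\Omega_{\mathcal C}$. When $K$ is a Kirby diagram of $M$, $I_F(M)$ denotes this number $I_F(L)$. **The state sum.** An *object labelling* assigns to every 2-handle $j$ an object $X_j\in\Lambda_{\mathcal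 C}$. For every object labelling and every 1-handle, choose bases $(\iota_i)$ of $\mathcal D(FX_1\otimes\cdots\otimes FX_N,I)$ and $(\iota^i)$ of $\mathcal D(I,FX_1\otimes\cdots\otimes FX_N)$ that are dual for the pairing $\langle f,g\rangle=\operatorname{tr}(g\circ f)$, where $1,\dots,N$ are the strands at the $+$-ball and the objects on leaving strands are dualised. A *morphism labelling* chooses an index $i$ for every 1-handle, and puts $\iota_i$ on its $+$-ball and $\iota^i$ on its $-$-ball. Let $\langle K(F)\rangle$ be the sum, over all object labellings and morphism labellings, of $\prod_j d(X_j)$ times the value in $\mathcal D(I,I)\cong\mathbb C$ of the diagram $K$ so labelled. **Claim.** For all such $F$, $K$, $L$ and all choices of dual bases, $$I_F(L)=\frac{\langle K(F)\rangle}{(\dim\Omega_{\mathcal C})^{h_2-h_1}\,n^{h_1}} .$$ In particular this is the value of $I_F(M)$ when $K$ is a Kirby diagram of a smooth, closed, oriented four-manifold $M$. -/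

import Mathlib

open CategoryTheory MonoidalCategory

universe v₁ u₁ v₂ u₂

noncomputable section

namespace Dichromatic

/-! ### Simple objects, fusion categories -/

section Linear

variable {C : Type u₁} [Category.{v₁} C] [Preadditive C] [Linear ℂ C]

/-- An object is simple if its endomorphism algebra is the ground field `ℂ`. -/
def IsSimple (X : C) : Prop := Module.finrank ℂ (X ⟶ X) = 1

theorem IsSimple.exists_smul_id {X : C} (h : IsSimple X) (f : X ⟶ X) :
    ∃ c : ℂ, f = c • 𝟙 X := by
  have hne : 𝟙 X ≠ 0 := by
    intro h0
    have hz : ∀ g : X ⟶ X, g = 0 := fun g => by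
      rw [← Category.comp_id g, h0, Limits.comp_zero]
    have : Subsingleton (X ⟶ X) := ⟨fun a b => by rw [hz a, hz b]⟩
    have h1 : Module.finrank ℂ (X ⟶ X) = 0 := Module.finrank_zero_of_subsingleton
    rw [IsSimple] at h
    omega
  obtain ⟨c, hc⟩ := (finrank_eq_one_iff_of_nonzero' (𝟙 X) hne).1 h f
  exact ⟨c, hc.symm⟩

/-- The composition map `⨁_Z C(X, Z) ⊗ C(Z, Y) → C(X, Y)`, for a finite family of objects `Z`. -/
def composition {I : Type} [Fintype I] (Z : I → C) (X Y : C) :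
    (∀ i, TensorProduct ℂ (X ⟶ Z i) (Z i ⟶ Y)) →ₗ[ℂ] (X ⟶ Y) :=
  ∑ i, (TensorProduct.lift (Linear.comp X (Z i) Y)).comp (LinearMap.proj i)

end Linear

/-- A fusion category over `ℂ`: a finitely semisimple rigid linear monoidal category with simple
unit. The chosen dual of `X` is `ᘁX`, with `ev : X ⊗ ᘁX ⟶ 𝟙_` and `coev : 𝟙_ ⟶ ᘁX ⊗ X`; the
duals on the other side are provided by the pivotal structure. -/
class FusionCategory (C : Type u₁) [Category.{v₁} C] [Preadditive C] [Linear ℂ C]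
    [MonoidalCategory C] [MonoidalPreadditive C] [MonoidalLinear ℂ C]
    [LeftRigidCategory C] where
  /-- hom-spaces are finite-dimensional -/
  finite_hom : ∀ X Y : C, Module.Finite ℂ (X ⟶ Y)
  /-- biproducts exist -/
  hasFiniteBiproducts : Limits.HasFiniteBiproducts C
  /-- idempotents split -/
  idempotentComplete : IsIdempotentComplete C
  /-- labels of the simple objects -/
  Irr : Type
  /-- there are finitely many of them -/
  fintypeIrr : Fintype Irr
  /-- representatives of the simple objects -/
  simple : Irr → C
  isSimple : ∀ Z, IsSimple (simple Z)
  inequivalent : ∀ Z Z', Nonempty (simple Z ≅ simple Z') → Z = Z'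
  bijective_composition : ∀ X Y : C, Function.Bijective (composition simple X Y)
  unit_isSimple : IsSimple (𝟙_ C)

attribute [instance] FusionCategory.finite_hom FusionCategory.hasFiniteBiproducts
  FusionCategory.idempotentComplete

/-- The labels of the simple objects of a fusion category. -/
abbrev Irr (C : Type u₁) [Category.{v₁} C] [Preadditive C] [Linear ℂ C]
    [MonoidalCategory C] [MonoidalPreadditive C] [MonoidalLinear ℂ C]
    [LeftRigidCategory C] [FusionCategory C] : Type := FusionCategory.Irr C

instance (C : Type u₁) [Category.{v₁} C] [Preadditive C] [Linear ℂ C]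
    [MonoidalCategory C] [MonoidalPreadditive C] [MonoidalLinear ℂ C]
    [LeftRigidCategory C] [FusionCategory C] : Fintype (Irr C) := FusionCategory.fintypeIrr

/-- The simple object with a given label. -/
abbrev simple {C : Type u₁} [Category.{v₁} C] [Preadditive C] [Linear ℂ C]
    [MonoidalCategory C] [MonoidalPreadditive C] [MonoidalLinear ℂ C]
    [LeftRigidCategory C] [FusionCategory C] (Z : Irr C) : C := FusionCategory.simple Z

/-- The complex number corresponding to an endomorphism of the unit. -/
def scalar {C : Type u₁} [Category.{v₁} C] [Preadditive C] [Linear ℂ C]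
    [MonoidalCategory C] [MonoidalPreadditive C] [MonoidalLinear ℂ C]
    [LeftRigidCategory C] [FusionCategory C] (f : 𝟙_ C ⟶ 𝟙_ C) : ℂ :=
  Classical.choose (FusionCategory.unit_isSimple.exists_smul_id f)

theorem scalar_spec {C : Type u₁} [Category.{v₁} C] [Preadditive C] [Linear ℂ C]
    [MonoidalCategory C] [MonoidalPreadditive C] [MonoidalLinear ℂ C]
    [LeftRigidCategory C] [FusionCategory C] (f : 𝟙_ C ⟶ 𝟙_ C) : f = scalar f • 𝟙 (𝟙_ C) :=
  Classical.choose_spec (FusionCategory.unit_isSimple.exists_smul_id f)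

/-! ### Pivotal, spherical and ribbon categories -/

section Pivotal

variable {C : Type u₁} [Category.{v₁} C] [MonoidalCategory C] [LeftRigidCategory C]

/-- The chosen dual of an object (also of the unit, whose chosen dual need not be the unit). -/
abbrev dual (X : C) : C := ᘁX

/-- The dual of a morphism. -/
abbrev dualMap {X Y : C} (f : X ⟶ Y) : dual Y ⟶ dual X := ᘁf

/-- Evaluation `X ⊗ X* ⟶ 𝟙_`. -/
def evR (X : C) : X ⊗ (ᘁX) ⟶ 𝟙_ C := ε_ (ᘁX) X

/-- Coevaluation `𝟙_ ⟶ X* ⊗ X`. -/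
def coevR (X : C) : 𝟙_ C ⟶ (ᘁX) ⊗ X := η_ (ᘁX) X

/-- The canonical isomorphism `Y* ⊗ X* ⟶ (X ⊗ Y)*`. -/
def dualTensor (X Y : C) : (ᘁY) ⊗ (ᘁX) ⟶ (ᘁ(X ⊗ Y)) :=
  (λ_ _).inv ≫ (coevR (X ⊗ Y) ▷ _) ≫ (α_ _ _ _).hom ≫
    (_ ◁ ((α_ X Y _).hom ≫ (X ◁ (α_ Y _ _).inv) ≫ (X ◁ (evR Y ▷ _)) ≫ (X ◁ (λ_ _).hom) ≫ evR X)) ≫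
    (ρ_ _).hom

variable (C) in
/-- The canonical isomorphism `𝟙_ ⟶ 𝟙_*`. -/
def dualUnit : 𝟙_ C ⟶ dual (𝟙_ C) := coevR (𝟙_ C) ≫ (ρ_ (dual (𝟙_ C))).hom

variable (C) in
/-- A pivotal structure: a monoidal natural isomorphism from the identity to the double dual. -/
class PivotalCategory where
  pivot : ∀ X : C, X ≅ (ᘁ(ᘁX))
  pivot_naturality : ∀ {X Y : C} (f : X ⟶ Y),
    f ≫ (pivot Y).hom = (pivot X).hom ≫ (ᘁ(ᘁf))
  pivot_tensor : ∀ X Y : C,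
    (pivot (X ⊗ Y)).hom ≫ (ᘁ(dualTensor X Y)) =
      ((pivot X).hom ⊗ₘ (pivot Y).hom) ≫ dualTensor (ᘁY) (ᘁX)
  pivot_unit : (pivot (𝟙_ C)).hom ≫ dualMap (dualUnit C) = dualUnit C

/-- The component of the pivotal structure at `X`. -/
abbrev pivot [PivotalCategory C] (X : C) : X ≅ (ᘁ(ᘁX)) := PivotalCategory.pivot X

/-- Evaluation on the other side, `X* ⊗ X ⟶ 𝟙_`. -/
def evL [PivotalCategory C] (X : C) : (ᘁX) ⊗ X ⟶ 𝟙_ C := ((ᘁX) ◁ (pivot X).hom) ≫ evR (ᘁX)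

/-- Coevaluation on the other side, `𝟙_ ⟶ X ⊗ X*`. -/
def coevL [PivotalCategory C] (X : C) : 𝟙_ C ⟶ X ⊗ (ᘁX) := coevR (ᘁX) ≫ ((pivot X).inv ▷ (ᘁX))

/-- Right trace. -/
def trR [PivotalCategory C] {X : C} (f : X ⟶ X) : 𝟙_ C ⟶ 𝟙_ C := coevL X ≫ (f ▷ (ᘁX)) ≫ evR X

/-- Left trace. -/
def trL [PivotalCategory C] {X : C} (f : X ⟶ X) : 𝟙_ C ⟶ 𝟙_ C := coevR X ≫ ((ᘁX) ◁ f) ≫ evL X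

variable (C) in
/-- A spherical category: left and right traces agree. -/
class SphericalCategory [PivotalCategory C] : Prop where
  trR_eq_trL : ∀ {X : C} (f : X ⟶ X), trR f = trL f

variable (C) in
/-- A ribbon category: a twist satisfying the balance equation and the ribbon equation. The pivotal
structure is the canonical one, that is, the twist is the curl determined by the pivotal
structure. -/
class RibbonCategory [BraidedCategory C] [PivotalCategory C] where
  twist : ∀ X : C, X ≅ X
  twist_naturality : ∀ {X Y : C} (f : X ⟶ Y), f ≫ (twist Y).hom = (twist X).hom ≫ f
  balance : ∀ X Y : C, (twist (X ⊗ Y)).hom =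
    ((twist X).hom ⊗ₘ (twist Y).hom) ≫ (β_ X Y).hom ≫ (β_ Y X).hom
  ribbon : ∀ X : C, (twist (ᘁX)).hom = (ᘁ(twist X).hom)
  twist_eq_curl : ∀ X : C, (twist X).hom =
    (ρ_ X).inv ≫ (X ◁ coevR (ᘁX)) ≫ (α_ _ _ _).inv ≫ ((β_ X (ᘁ(ᘁX))).hom ▷ (ᘁX)) ≫
      (α_ _ _ _).hom ≫ ((ᘁ(ᘁX)) ◁ evR X) ≫ (ρ_ _).hom ≫ (pivot X).inv

/-- An object is transparent if it braids trivially with every object. -/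
def Transparent [BraidedCategory C] (X : C) : Prop :=
  ∀ Y : C, (β_ X Y).hom ≫ (β_ Y X).hom = 𝟙 (X ⊗ Y)

end Pivotal

/-! ### Pivotal functors -/

section Functor

variable {C : Type u₁} [Category.{v₁} C] [MonoidalCategory C] [LeftRigidCategory C]
  {D : Type u₂} [Category.{v₂} D] [MonoidalCategory D] [LeftRigidCategory D]

/-- The canonical isomorphism `F(X*) ⟶ (F X)*` of a strong monoidal functor. -/
def dualComparison (F : C ⥤ D) [F.Monoidal] (X : C) : F.obj (ᘁX) ⟶ (ᘁ(F.obj X)) :=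
  (λ_ _).inv ≫ (coevR (F.obj X) ▷ _) ≫ (α_ _ _ _).hom ≫
    (_ ◁ (Functor.LaxMonoidal.μ F X (ᘁX) ≫ F.map (evR X) ≫ Functor.OplaxMonoidal.η F)) ≫
    (ρ_ _).hom

/-- A pivotal functor: a strong monoidal functor that preserves the pivotal structure up to the
canonical isomorphisms. -/
class IsPivotalFunctor [PivotalCategory C] [PivotalCategory D] (F : C ⥤ D) [F.Monoidal] :
    Prop where
  map_pivot : ∀ X : C, (pivot (F.obj X)).hom ≫ (ᘁ(dualComparison F X)) =
    F.map (pivot X).hom ≫ dualComparison F (ᘁX)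

end Functor

/-! ### Dimensions, colours, modularity -/

section Dimensions

variable {C : Type u₁} [Category.{v₁} C] [Preadditive C] [Linear ℂ C]
  [MonoidalCategory C] [MonoidalPreadditive C] [MonoidalLinear ℂ C]
  [LeftRigidCategory C] [PivotalCategory C] [FusionCategory C]

/-- The trace as a complex number. -/
def tr {X : C} (f : X ⟶ X) : ℂ := scalar (trR f)

/-- The (quantum) dimension of an object. -/
def dim (X : C) : ℂ := tr (𝟙 X)

/-- The pairing `⟨f, g⟩ = tr (g ∘ f)` of `f : X ⟶ Y` and `g : Y ⟶ X`. -/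
def sphericalPairing {X Y : C} (f : X ⟶ Y) (g : Y ⟶ X) : ℂ := tr (f ≫ g)

/-- Dual bases of `C(Y, 𝟙_)` and `C(𝟙_, Y)` with respect to the spherical pairing. -/
structure DualBases (Y : C) where
  card : ℕ
  basis : Module.Basis (Fin card) ℂ (Y ⟶ 𝟙_ C)
  dual : Module.Basis (Fin card) ℂ (𝟙_ C ⟶ Y)
  pairing : ∀ i j, sphericalPairing (basis i) (dual j) = if i = j then 1 else 0

variable (C) in
/-- The global dimension: the dimension of the Kirby colour `Ω = ∑_Z dim(Z) Z`. -/
def globalDim : ℂ := ∑ Z : Irr C, dim (simple Z) ^ 2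

variable (C) in
/-- Colours: elements of the fusion algebra, written in the basis of simple objects. -/
abbrev Colour : Type := Irr C → ℂ

/-- The class of an object in the fusion algebra: its multiplicities. -/
def colourOf (X : C) : Colour C := fun Z => (Module.finrank ℂ (X ⟶ simple Z) : ℂ)

/-- The dimension of a colour. -/
def Colour.dim (c : Colour C) : ℂ := ∑ Z, c Z * Dichromatic.dim (simple Z)

open scoped Classical in
/-- The transparent part of a colour. -/
def Colour.transparentPart [BraidedCategory C] (c : Colour C) : Colour C :=
  fun Z => if Transparent (simple Z) then c Z else 0

variable (C) in
/-- A ribbon fusion category is modular if every transparent simple object is isomorphic to the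
unit. -/
class IsModular [BraidedCategory C] [RibbonCategory C] : Prop where
  iso_unit : ∀ Z : Irr C, Transparent (simple Z) → Nonempty (simple Z ≅ 𝟙_ C)

variable {D : Type u₂} [Category.{v₂} D] [Preadditive D] [Linear ℂ D]
  [MonoidalCategory D] [MonoidalPreadditive D] [MonoidalLinear ℂ D]
  [LeftRigidCategory D] [PivotalCategory D] [FusionCategory D]

/-- The colour `FΩ_C = ∑_X dim(X) F(X)` of `D`. -/
def kirbyColourImage (F : C ⥤ D) : Colour D :=
  ∑ X : Irr C, dim (simple X) • colourOf (F.obj (simple X))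

/-- The multiplicity of the unit in `FΩ_C = ∑_X dim(X) F(X)`. -/
def unitMultiplicity (F : C ⥤ D) : ℂ :=
  ∑ X : Irr C, dim (simple X) * (Module.finrank ℂ (F.obj (simple X) ⟶ 𝟙_ D) : ℂ)

end Dimensions

/-! ### Diagrams

A diagram in the plane is read from bottom to top. It is built from elementary pieces by vertical
composition and horizontal juxtaposition; the bracketings of its rows of points are recorded. -/

/-- A bracketed row of points on oriented strands. The strands carry labels in `ι`; at a point
`strand j true` a strand with label `j` points upwards, at `strand j false` downwards. -/
inductive Word (ι : Type) : Type
  | unit : Word ι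
  | strand : ι → Bool → Word ι
  | tensor : Word ι → Word ι → Word ι

/-- A family of boxes that may occur in a diagram, with their incoming and outgoing strands. -/
structure BoxSig (ι : Type) where
  Box : Type
  dom : Box → Word ι
  cod : Box → Word ι

/-- Elementary pieces of diagrams: rebracketings, the two kinds of crossings of two bundles of
parallel strands, maxima, minima, boxes. In `braid X Y` the strands of `X`, which go from bottom
left to top right, are on top. -/
inductive Piece {ι : Type} (S : BoxSig ι) : Word ι → Word ι → Type
  | assoc (X Y Z : Word ι) : Piece S ((X.tensor Y).tensor Z) (X.tensor (Y.tensor Z))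
  | assocInv (X Y Z : Word ι) : Piece S (X.tensor (Y.tensor Z)) ((X.tensor Y).tensor Z)
  | leftUnit (X : Word ι) : Piece S (Word.unit.tensor X) X
  | leftUnitInv (X : Word ι) : Piece S X (Word.unit.tensor X)
  | rightUnit (X : Word ι) : Piece S (X.tensor Word.unit) X
  | rightUnitInv (X : Word ι) : Piece S X (X.tensor Word.unit)
  | braid (X Y : Word ι) : Piece S (X.tensor Y) (Y.tensor X)
  | braidInv (X Y : Word ι) : Piece S (Y.tensor X) (X.tensor Y)
  | cap (j : ι) (b : Bool) : Piece S ((Word.strand j b).tensor (Word.strand j !b)) Word.unit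
  | cup (j : ι) (b : Bool) : Piece S Word.unit ((Word.strand j b).tensor (Word.strand j !b))
  | box (b : S.Box) : Piece S (S.dom b) (S.cod b)

/-- Diagrams with a given bottom row and top row. -/
inductive Diagram {ι : Type} (S : BoxSig ι) : Word ι → Word ι → Type
  | piece {X Y : Word ι} (p : Piece S X Y) : Diagram S X Y
  | id (X : Word ι) : Diagram S X X
  | comp {X Y Z : Word ι} (f : Diagram S X Y) (g : Diagram S Y Z) : Diagram S X Z
  | tensor {X Y X' Y' : Word ι} (f : Diagram S X Y) (g : Diagram S X' Y') :
      Diagram S (X.tensor X') (Y.tensor Y')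

/-- A diagram without open ends. -/
abbrev ClosedDiagram {ι : Type} (S : BoxSig ι) : Type := Diagram S Word.unit Word.unit

namespace Diagram

variable {ι : Type} {S : BoxSig ι}

/-- One strand of a diagram with a curl of blackboard framing `+1`. -/
def curl (j : ι) (b : Bool) : Diagram S (.strand j b) (.strand j b) :=
  (piece (.rightUnitInv _)).comp <| ((id _).tensor (piece (.cup j b))).comp <|
  (piece (.assocInv _ _ _)).comp <|
  ((piece (.braid (.strand j b) (.strand j b))).tensor (id _)).comp <|
  (piece (.assoc _ _ _)).comp <| ((id _).tensor (piece (.cap j b))).comp <|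
  piece (.rightUnit _)

/-- One strand of a diagram with a curl of blackboard framing `-1`. -/
def curlInv (j : ι) (b : Bool) : Diagram S (.strand j b) (.strand j b) :=
  (piece (.rightUnitInv _)).comp <| ((id _).tensor (piece (.cup j b))).comp <|
  (piece (.assocInv _ _ _)).comp <|
  ((piece (.braidInv (.strand j b) (.strand j b))).tensor (id _)).comp <|
  (piece (.assoc _ _ _)).comp <| ((id _).tensor (piece (.cap j b))).comp <|
  piece (.rightUnit _)

/-- A full twist of a bundle of parallel strands. -/
def fullTwist : ∀ X : Word ι, Diagram S X X
  | .unit => id _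
  | .strand j b => curl j b
  | .tensor X Y => ((fullTwist X).tensor (fullTwist Y)).comp
      ((piece (.braid X Y)).comp (piece (.braid Y X)))

/-- Isotopy of diagrams (with blackboard framing, the boxes being rigid horizontal coupons): the
congruence generated by planar isotopy, including the straightening of zigzags, the second and third
Reidemeister moves, moving any part of a diagram across a strand, the framed first Reidemeister
move, and full rotations of any part of a diagram. -/
inductive Isotopic : ∀ {X Y : Word ι}, Diagram S X Y → Diagram S X Y → Prop
  -- equivalence relation and congruence
  | refl {X Y} (f : Diagram S X Y) : Isotopic f f
  | symm {X Y} {f g : Diagram S X Y} : Isotopic f g → Isotopic g f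
  | trans {X Y} {f g h : Diagram S X Y} : Isotopic f g → Isotopic g h → Isotopic f h
  | comp {X Y Z} {f f' : Diagram S X Y} {g g' : Diagram S Y Z} :
      Isotopic f f' → Isotopic g g' → Isotopic (f.comp g) (f'.comp g')
  | tensor {X Y X' Y'} {f f' : Diagram S X Y} {g g' : Diagram S X' Y'} :
      Isotopic f f' → Isotopic g g' → Isotopic (f.tensor g) (f'.tensor g')
  -- planar isotopy of upward strands and boxes
  | comp_id {X Y} (f : Diagram S X Y) : Isotopic (f.comp (id Y)) f
  | id_comp {X Y} (f : Diagram S X Y) : Isotopic ((id X).comp f) f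
  | comp_assoc {X Y Z W} (f : Diagram S X Y) (g : Diagram S Y Z) (h : Diagram S Z W) :
      Isotopic ((f.comp g).comp h) (f.comp (g.comp h))
  | tensor_id (X Y) : Isotopic ((id X).tensor (id Y)) (id (X.tensor Y))
  | tensor_comp {X Y Z X' Y' Z'} (f : Diagram S X Y) (g : Diagram S Y Z)
      (f' : Diagram S X' Y') (g' : Diagram S Y' Z') :
      Isotopic ((f.comp g).tensor (f'.comp g')) ((f.tensor f').comp (g.tensor g'))
  | assoc_assocInv (X Y Z) :
      Isotopic ((piece (.assoc X Y Z)).comp (piece (.assocInv X Y Z))) (id _)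
  | assocInv_assoc (X Y Z) :
      Isotopic ((piece (.assocInv X Y Z)).comp (piece (.assoc X Y Z))) (id _)
  | assoc_naturality {X X' Y Y' Z Z'} (f : Diagram S X X') (g : Diagram S Y Y')
      (h : Diagram S Z Z') :
      Isotopic (((f.tensor g).tensor h).comp (piece (.assoc X' Y' Z')))
        ((piece (.assoc X Y Z)).comp (f.tensor (g.tensor h)))
  | leftUnit_leftUnitInv (X) :
      Isotopic ((piece (.leftUnit X)).comp (piece (.leftUnitInv X))) (id _)
  | leftUnitInv_leftUnit (X) :
      Isotopic ((piece (.leftUnitInv X)).comp (piece (.leftUnit X))) (id _)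
  | leftUnit_naturality {X Y} (f : Diagram S X Y) :
      Isotopic (((id .unit).tensor f).comp (piece (.leftUnit Y)))
        ((piece (.leftUnit X)).comp f)
  | rightUnit_rightUnitInv (X) :
      Isotopic ((piece (.rightUnit X)).comp (piece (.rightUnitInv X))) (id _)
  | rightUnitInv_rightUnit (X) :
      Isotopic ((piece (.rightUnitInv X)).comp (piece (.rightUnit X))) (id _)
  | rightUnit_naturality {X Y} (f : Diagram S X Y) :
      Isotopic ((f.tensor (id .unit)).comp (piece (.rightUnit Y)))
        ((piece (.rightUnit X)).comp f)
  | pentagon (W X Y Z) :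
      Isotopic
        (((piece (.assoc W X Y)).tensor (id Z)).comp
          ((piece (.assoc W (X.tensor Y) Z)).comp ((id W).tensor (piece (.assoc X Y Z)))))
        ((piece (.assoc (W.tensor X) Y Z)).comp (piece (.assoc W X (Y.tensor Z))))
  | triangle (X Y) :
      Isotopic ((piece (.assoc X .unit Y)).comp ((id X).tensor (piece (.leftUnit Y))))
        ((piece (.rightUnit X)).tensor (id Y))
  -- straightening of zigzags
  | zigzag_left (j) :
      Isotopic
        ((piece (.leftUnitInv _)).comp <| ((piece (.cup j true)).tensor (id _)).comp <|
          (piece (.assoc _ _ _)).comp <| ((id _).tensor (piece (.cap j false))).comp <|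
          piece (.rightUnit _))
        (id (.strand j true))
  | zigzag_right (j) :
      Isotopic
        ((piece (.rightUnitInv _)).comp <| ((id _).tensor (piece (.cup j false))).comp <|
          (piece (.assocInv _ _ _)).comp <| ((piece (.cap j true)).tensor (id _)).comp <|
          piece (.leftUnit _))
        (id (.strand j true))
  | zigzag_left' (j) :
      Isotopic
        ((piece (.leftUnitInv _)).comp <| ((piece (.cup j false)).tensor (id _)).comp <|
          (piece (.assoc _ _ _)).comp <| ((id _).tensor (piece (.cap j true))).comp <|
          piece (.rightUnit _))
        (id (.strand j false))
  | zigzag_right' (j) :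
      Isotopic
        ((piece (.rightUnitInv _)).comp <| ((id _).tensor (piece (.cup j true))).comp <|
          (piece (.assocInv _ _ _)).comp <| ((piece (.cap j false)).tensor (id _)).comp <|
          piece (.leftUnit _))
        (id (.strand j false))
  -- second Reidemeister move
  | braid_braidInv (X Y) :
      Isotopic ((piece (.braid X Y)).comp (piece (.braidInv X Y))) (id _)
  | braidInv_braid (X Y) :
      Isotopic ((piece (.braidInv X Y)).comp (piece (.braid X Y))) (id _)
  -- third Reidemeister move, and moving any part of a diagram across other strands
  | braid_naturality {X X' Y Y'} (f : Diagram S X X') (g : Diagram S Y Y') :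
      Isotopic ((f.tensor g).comp (piece (.braid X' Y'))) ((piece (.braid X Y)).comp (g.tensor f))
  -- crossings of bundles are composed of crossings of their parts
  | hexagon_forward (X Y Z) :
      Isotopic
        ((piece (.assoc X Y Z)).comp
          ((piece (.braid X (Y.tensor Z))).comp (piece (.assoc Y Z X))))
        (((piece (.braid X Y)).tensor (id Z)).comp
          ((piece (.assoc Y X Z)).comp ((id Y).tensor (piece (.braid X Z)))))
  | hexagon_reverse (X Y Z) :
      Isotopic
        ((piece (.assocInv X Y Z)).comp
          ((piece (.braid (X.tensor Y) Z)).comp (piece (.assocInv Z X Y))))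
        (((id X).tensor (piece (.braid Y Z))).comp
          ((piece (.assocInv X Z Y)).comp ((piece (.braid X Z)).tensor (id Y))))
  -- framed first Reidemeister move
  | curl_curlInv (j b) : Isotopic ((curl j b).comp (curlInv j b)) (id _)
  | curlInv_curl (j b) : Isotopic ((curlInv j b).comp (curl j b)) (id _)
  | curl_cap (j b) :
      Isotopic (((curl j b).tensor (id _)).comp (piece (.cap j b)))
        (((id _).tensor (curl j !b)).comp (piece (.cap j b)))
  -- rotating a part of a diagram by a full turn
  | fullTwist_naturality {X Y} (f : Diagram S X Y) :
      Isotopic ((fullTwist X).comp f) (f.comp (fullTwist Y))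

end Diagram

/-! ### Replacing boxes and labels in diagrams -/

section Replacement

variable {ι ι' : Type}

/-- Rename the labels of strands. -/
def Word.relabel (g : ι → ι') : Word ι → Word ι'
  | .unit => .unit
  | .strand j b => .strand (g j) b
  | .tensor X Y => (X.relabel g).tensor (Y.relabel g)

/-- Rename the labels of strands. -/
def BoxSig.relabel (g : ι → ι') (S : BoxSig ι) : BoxSig ι' where
  Box := S.Box
  dom b := (S.dom b).relabel g
  cod b := (S.cod b).relabel g

/-- Rename the labels of strands. -/
def Piece.relabel (g : ι → ι') {S : BoxSig ι} :
    ∀ {X Y : Word ι}, Piece S X Y → Piece (S.relabel g) (X.relabel g) (Y.relabel g)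
  | _, _, .assoc _ _ _ => .assoc _ _ _
  | _, _, .assocInv _ _ _ => .assocInv _ _ _
  | _, _, .leftUnit _ => .leftUnit _
  | _, _, .leftUnitInv _ => .leftUnitInv _
  | _, _, .rightUnit _ => .rightUnit _
  | _, _, .rightUnitInv _ => .rightUnitInv _
  | _, _, .braid _ _ => .braid _ _
  | _, _, .braidInv _ _ => .braidInv _ _
  | _, _, .cap j b => .cap (g j) b
  | _, _, .cup j b => .cup (g j) b
  | _, _, .box b => .box (S := S.relabel g) b

/-- Rename the labels of strands. -/
def Diagram.relabel (g : ι → ι') {S : BoxSig ι} :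
    ∀ {X Y : Word ι}, Diagram S X Y → Diagram (S.relabel g) (X.relabel g) (Y.relabel g)
  | _, _, .piece p => .piece (p.relabel g)
  | _, _, .id X => .id (X.relabel g)
  | _, _, .comp f f' => (f.relabel g).comp (f'.relabel g)
  | _, _, .tensor f f' => (f.relabel g).tensor (f'.relabel g)

/-- Replace every box by a diagram. -/
def Piece.subst {S S' : BoxSig ι} (φ : ∀ b, Diagram S' (S.dom b) (S.cod b)) :
    ∀ {X Y : Word ι}, Piece S X Y → Diagram S' X Y
  | _, _, .assoc _ _ _ => .piece (.assoc _ _ _)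
  | _, _, .assocInv _ _ _ => .piece (.assocInv _ _ _)
  | _, _, .leftUnit _ => .piece (.leftUnit _)
  | _, _, .leftUnitInv _ => .piece (.leftUnitInv _)
  | _, _, .rightUnit _ => .piece (.rightUnit _)
  | _, _, .rightUnitInv _ => .piece (.rightUnitInv _)
  | _, _, .braid _ _ => .piece (.braid _ _)
  | _, _, .braidInv _ _ => .piece (.braidInv _ _)
  | _, _, .cap j b => .piece (.cap j b)
  | _, _, .cup j b => .piece (.cup j b)
  | _, _, .box b => φ b

/-- Replace every box by a diagram. -/
def Diagram.subst {S S' : BoxSig ι} (φ : ∀ b, Diagram S' (S.dom b) (S.cod b)) :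
    ∀ {X Y : Word ι}, Diagram S X Y → Diagram S' X Y
  | _, _, .piece p => p.subst φ
  | _, _, .id X => .id X
  | _, _, .comp f f' => (f.subst φ).comp (f'.subst φ)
  | _, _, .tensor f f' => (f.subst φ).tensor (f'.subst φ)

end Replacement

/-! ### The circles of a diagram -/

section Circles

variable {ι : Type}

/-- The points in a row. -/
def Word.Pos : Word ι → Type
  | .unit => Empty
  | .strand _ _ => Unit
  | .tensor X Y => X.Pos ⊕ Y.Pos

/-- The label of the strand through a point in a row. -/
def Word.label : ∀ X : Word ι, X.Pos → ι
  | .unit => fun x => x.elim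
  | .strand j _ => fun _ => j
  | .tensor X Y => Sum.elim X.label Y.label

/-- The positions of a row as seen through a rebracketing. -/
def Word.assocPos (X Y Z : Word ι) :
    ((X.tensor Y).tensor Z).Pos ≃ (X.tensor (Y.tensor Z)).Pos :=
  Equiv.sumAssoc X.Pos Y.Pos Z.Pos

/-- The pairs of end points (at the bottom: `inl`, at the top: `inr`) that are joined by a strand
of an elementary piece. -/
inductive Piece.Joins {S : BoxSig ι} :
    ∀ {X Y : Word ι}, Piece S X Y → X.Pos ⊕ Y.Pos → X.Pos ⊕ Y.Pos → Prop
  | assoc (X Y Z) (x) : Joins (.assoc X Y Z) (.inl x) (.inr (Word.assocPos X Y Z x))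
  | assocInv (X Y Z) (x) : Joins (.assocInv X Y Z) (.inl (Word.assocPos X Y Z x)) (.inr x)
  | leftUnit (X) (x : X.Pos) : Joins (.leftUnit X) (.inl (Sum.inr x)) (.inr x)
  | leftUnitInv (X) (x : X.Pos) : Joins (.leftUnitInv X) (.inl x) (.inr (Sum.inr x))
  | rightUnit (X) (x : X.Pos) : Joins (.rightUnit X) (.inl (Sum.inl x)) (.inr x)
  | rightUnitInv (X) (x : X.Pos) : Joins (.rightUnitInv X) (.inl x) (.inr (Sum.inl x))
  | braid_fst (X Y) (x : X.Pos) : Joins (.braid X Y) (.inl (Sum.inl x)) (.inr (Sum.inr x))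
  | braid_snd (X Y) (y : Y.Pos) : Joins (.braid X Y) (.inl (Sum.inr y)) (.inr (Sum.inl y))
  | braidInv_fst (X Y) (x : X.Pos) : Joins (.braidInv X Y) (.inl (Sum.inr x)) (.inr (Sum.inl x))
  | braidInv_snd (X Y) (y : Y.Pos) : Joins (.braidInv X Y) (.inl (Sum.inl y)) (.inr (Sum.inr y))
  | cap (j b) : Joins (.cap j b) (.inl (Sum.inl ())) (.inl (Sum.inr ()))
  | cup (j b) : Joins (.cup j b) (.inr (Sum.inl ())) (.inr (Sum.inr ()))

namespace Diagram

variable {S : BoxSig ι}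

/-- The end points of the strands of all the pieces of a diagram. -/
def Pt : ∀ {X Y : Word ι}, Diagram S X Y → Type
  | X, Y, .piece _ => X.Pos ⊕ Y.Pos
  | _, _, .id X => X.Pos
  | _, _, .comp f g => f.Pt ⊕ g.Pt
  | _, _, .tensor f g => f.Pt ⊕ g.Pt

/-- The points in the bottom row. -/
def bot : ∀ {X Y : Word ι} (f : Diagram S X Y), X.Pos → f.Pt
  | _, _, .piece _ => Sum.inl
  | _, _, .id _ => fun x => x
  | _, _, .comp f _ => fun x => Sum.inl (f.bot x)
  | _, _, .tensor f g => Sum.map f.bot g.bot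

/-- The points in the top row. -/
def top : ∀ {X Y : Word ι} (f : Diagram S X Y), Y.Pos → f.Pt
  | _, _, .piece _ => Sum.inr
  | _, _, .id _ => fun x => x
  | _, _, .comp _ g => fun x => Sum.inr (g.top x)
  | _, _, .tensor f g => Sum.map f.top g.top

/-- The label of the strand through a point. -/
def label : ∀ {X Y : Word ι} (f : Diagram S X Y), f.Pt → ι
  | X, Y, .piece _ => Sum.elim X.label Y.label
  | _, _, .id X => X.label
  | _, _, .comp f g => Sum.elim f.label g.label
  | _, _, .tensor f g => Sum.elim f.label g.label

/-- Points that are joined by a strand of a piece, or identified where two rows meet. -/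
def Joins : ∀ {X Y : Word ι} (f : Diagram S X Y), f.Pt → f.Pt → Prop
  | _, _, .piece p => p.Joins
  | _, _, .id _ => fun _ _ => False
  | _, _, .comp f g => fun x y =>
      Sum.LiftRel f.Joins g.Joins x y ∨ ∃ z, x = Sum.inl (f.top z) ∧ y = Sum.inr (g.bot z)
  | _, _, .tensor f g => Sum.LiftRel f.Joins g.Joins

/-- `x` is the incoming end point with position `z` at an occurrence of the box `b`. -/
def EntersBox (b : S.Box) (z : (S.dom b).Pos) : ∀ {X Y : Word ι} (f : Diagram S X Y), f.Pt → Prop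
  | _, _, .piece (.box b') => fun x => ∃ h : b = b', x = Sum.inl (h ▸ z)
  | _, _, .piece _ => fun _ => False
  | _, _, .id _ => fun _ => False
  | _, _, .comp f g => Sum.elim (f.EntersBox b z) (g.EntersBox b z)
  | _, _, .tensor f g => Sum.elim (f.EntersBox b z) (g.EntersBox b z)

/-- `x` is the outgoing end point with position `z` at an occurrence of the box `b`. -/
def LeavesBox (b : S.Box) (z : (S.cod b).Pos) : ∀ {X Y : Word ι} (f : Diagram S X Y), f.Pt → Prop
  | _, _, .piece (.box b') => fun x => ∃ h : b = b', x = Sum.inr (h ▸ z)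
  | _, _, .piece _ => fun _ => False
  | _, _, .id _ => fun _ => False
  | _, _, .comp f g => Sum.elim (f.LeavesBox b z) (g.LeavesBox b z)
  | _, _, .tensor f g => Sum.elim (f.LeavesBox b z) (g.LeavesBox b z)

open scoped Classical in
/-- The number of occurrences of a box. -/
def boxCount (b : S.Box) : ∀ {X Y : Word ι}, Diagram S X Y → ℕ
  | _, _, .piece (.box b') => if b = b' then 1 else 0
  | _, _, .piece _ => 0
  | _, _, .id _ => 0
  | _, _, .comp f g => f.boxCount b + g.boxCount b
  | _, _, .tensor f g => f.boxCount b + g.boxCount b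

/-- The strands with label `j` form exactly one component, when strands are joined inside the
diagram and by the additional relation `R`. -/
def IsOneComponent {X Y : Word ι} (f : Diagram S X Y) (R : f.Pt → f.Pt → Prop) (j : ι) : Prop :=
  (∃ x, f.label x = j) ∧
    ∀ x y, f.label x = j → f.label y = j →
      Relation.EqvGen (fun x y => f.Joins x y ∨ R x y) x y

end Diagram

end Circles

/-! ### Kirby diagrams and special framed links -/

/-- The balls of the 1-handles as boxes. The strands in the row `foot a` enter the `+`-ball
`(a, true)` of the 1-handle `a` from below, and leave its `-`-ball `(a, false)` upwards in the same
order; the two balls are identified by a reflection in a horizontal plane and a translation. -/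
def ballSig {h₁ h₂ : ℕ} (foot : Fin h₁ → Word (Fin h₂)) : BoxSig (Fin h₂) where
  Box := Fin h₁ × Bool
  dom
    | (a, true) => foot a
    | (_, false) => Word.unit
  cod
    | (_, true) => Word.unit
    | (a, false) => foot a

/-- A Kirby diagram with `h₁` 1-handles and `h₂` 2-handles, with chosen signs of the balls of the
1-handles and chosen orientations of the attaching circles of the 2-handles. Each of the two balls
of every 1-handle occurs once, and for every 2-handle `j` the strands labelled `j`, continued through
the 1-handles, form one circle. -/
structure KirbyDiagram (h₁ h₂ : ℕ) where
  /-- the strands entering the `+`-ball of each 1-handle -/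
  foot : Fin h₁ → Word (Fin h₂)
  diagram : ClosedDiagram (ballSig foot)
  ball_once : ∀ b : Fin h₁ × Bool, diagram.boxCount (S := ballSig foot) b = 1
  isCircle : ∀ j : Fin h₂, diagram.IsOneComponent
    (fun x y => ∃ (a : Fin h₁) (z : (foot a).Pos),
      diagram.EntersBox (S := ballSig foot) (a, true) z x ∧
      diagram.LeavesBox (S := ballSig foot) (a, false) z y) j

/-- The signature without boxes. -/
def noBox (ι : Type) : BoxSig ι where
  Box := Empty
  dom b := b.elim
  cod b := b.elim

/-- A diagram of an oriented framed link (with blackboard framing) with `h₁` dotted components, which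
stand for 1-handles, and `h₂` undotted components, which stand for 2-handles. -/
structure DottedLink (h₁ h₂ : ℕ) where
  diagram : ClosedDiagram (noBox (Fin h₁ ⊕ Fin h₂))
  isCircle : ∀ j : Fin h₁ ⊕ Fin h₂, diagram.IsOneComponent (fun _ _ => False) j

/-- The 1-handles as boxes that stand for a `+`-ball and the `-`-ball directly above it. -/
def facingSig {h₁ h₂ : ℕ} (foot : Fin h₁ → Word (Fin h₂)) : BoxSig (Fin h₂) where
  Box := Fin h₁
  dom := foot
  cod := foot

/-- The `+`-ball of a 1-handle, with its `-`-ball directly above it. -/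
def facingBalls {h₁ h₂ : ℕ} (foot : Fin h₁ → Word (Fin h₂)) (a : Fin h₁) :
    Diagram (ballSig foot) (foot a) (foot a) :=
  Diagram.comp (S := ballSig foot) (Y := Word.unit)
    (.piece (.box (S := ballSig foot) (a, true))) (.piece (.box (S := ballSig foot) (a, false)))

/-- A bundle `X` of parallel strands, encircled by an unknotted circle with label `j` and framing
`0`. -/
def encircled {ι : Type} {S : BoxSig ι} (j : ι) (X : Word ι) : Diagram S X X :=
  (Diagram.piece (.rightUnitInv _)).comp <|
  ((Diagram.id _).tensor (.piece (.cup j true))).comp <|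
  (Diagram.piece (.assocInv _ _ _)).comp <|
  ((Diagram.piece (.braid X (.strand j true))).tensor (.id _)).comp <|
  ((Diagram.piece (.braid (.strand j true) X)).tensor (.id _)).comp <|
  (Diagram.piece (.assoc _ _ _)).comp <|
  ((Diagram.id _).tensor (.piece (.cap j true))).comp <|
  .piece (.rightUnit _)

/-- `L` is obtained from the Kirby diagram `K` by passing to dotted circle notation: after an isotopy
that puts the two balls of every 1-handle opposite to each other (which amounts to the choice of the
cancelling 2-handle), every pair of balls is replaced by a dotted circle, and the strands that enter
the `+`-ball are continued through the dotted circle to the strands that leave the `-`-ball. -/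
def KirbyDiagram.HasDottedForm {h₁ h₂ : ℕ} (K : KirbyDiagram h₁ h₂) (L : DottedLink h₁ h₂) : Prop :=
  ∃ G : ClosedDiagram (facingSig K.foot),
    Diagram.Isotopic K.diagram (G.subst (S := facingSig K.foot) (facingBalls K.foot)) ∧
    Diagram.Isotopic L.diagram
      ((G.relabel (Sum.inr : Fin h₂ → Fin h₁ ⊕ Fin h₂)).subst
        (S := (facingSig K.foot).relabel Sum.inr)
        (fun a => encircled (Sum.inl a) ((K.foot a).relabel Sum.inr)))

/-! ### Evaluation of diagrams -/

section Evaluation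

variable {D : Type u₂} [Category.{v₂} D] [MonoidalCategory D] [LeftRigidCategory D]

/-- The object given by a row of points when the strands are labelled with objects. -/
def Word.obj {ι : Type} (X : ι → D) : Word ι → D
  | .unit => 𝟙_ D
  | .strand j true => X j
  | .strand j false => (ᘁ(X j))
  | .tensor V W => V.obj X ⊗ W.obj X

variable [BraidedCategory D] [PivotalCategory D] {ι : Type} {S : BoxSig ι}

/-- The morphism given by an elementary piece. -/
def Piece.eval (X : ι → D) (φ : ∀ b, (S.dom b).obj X ⟶ (S.cod b).obj X) :
    ∀ {V W : Word ι}, Piece S V W → (V.obj X ⟶ W.obj X)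
  | _, _, .assoc U V W => (α_ (U.obj X) (V.obj X) (W.obj X)).hom
  | _, _, .assocInv U V W => (α_ (U.obj X) (V.obj X) (W.obj X)).inv
  | _, _, .leftUnit V => (λ_ (V.obj X)).hom
  | _, _, .leftUnitInv V => (λ_ (V.obj X)).inv
  | _, _, .rightUnit V => (ρ_ (V.obj X)).hom
  | _, _, .rightUnitInv V => (ρ_ (V.obj X)).inv
  | _, _, .braid V W => (β_ (V.obj X) (W.obj X)).hom
  | _, _, .braidInv V W => (β_ (V.obj X) (W.obj X)).inv
  | _, _, .cap j true => evR (X j)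
  | _, _, .cap j false => evL (X j)
  | _, _, .cup j true => coevL (X j)
  | _, _, .cup j false => coevR (X j)
  | _, _, .box b => φ b

/-- The morphism given by a diagram. -/
def Diagram.eval (X : ι → D) (φ : ∀ b, (S.dom b).obj X ⟶ (S.cod b).obj X) :
    ∀ {V W : Word ι}, Diagram S V W → (V.obj X ⟶ W.obj X)
  | _, _, .piece p => p.eval X φ
  | _, _, .id V => 𝟙 (V.obj X)
  | _, _, .comp f g => f.eval X φ ≫ g.eval X φ
  | _, _, .tensor f g => f.eval X φ ⊗ₘ g.eval X φ

end Evaluation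

/-! ### The invariant -/

section Invariant

variable {C : Type u₁} [Category.{v₁} C] [Preadditive C] [Linear ℂ C]
  [MonoidalCategory C] [MonoidalPreadditive C] [MonoidalLinear ℂ C]
  [LeftRigidCategory C] [PivotalCategory C] [FusionCategory C]
  {D : Type u₂} [Category.{v₂} D] [Preadditive D] [Linear ℂ D]
  [MonoidalCategory D] [MonoidalPreadditive D] [MonoidalLinear ℂ D]
  [LeftRigidCategory D] [PivotalCategory D] [FusionCategory D]

/-- The evaluation `⟨L(Ω_D, FΩ_C)⟩`: the dotted components are labelled with the Kirby colour `Ω_D`,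
the undotted ones with `FΩ_C`. -/
def DottedLink.evaluation [BraidedCategory D] {h₁ h₂ : ℕ} (L : DottedLink h₁ h₂) (F : C ⥤ D) : ℂ :=
  ∑ Z : Fin h₁ → Irr D, ∑ X : Fin h₂ → Irr C,
    (∏ a, dim (simple (Z a))) * (∏ j, dim (simple (X j))) *
      scalar (L.diagram.eval (Sum.elim (fun a => simple (Z a)) (fun j => F.obj (simple (X j))))
        (fun b : Empty => b.elim))

/-- The generalised dichromatic invariant
`⟨L(Ω_D, FΩ_C)⟩ / (dim(Ω_C)^(h₂ - h₁) (dim(Ω_D) dim((FΩ_C)'))^h₁)`. -/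
def dichromaticInvariant [BraidedCategory D] {h₁ h₂ : ℕ} (F : C ⥤ D) (L : DottedLink h₁ h₂) : ℂ :=
  L.evaluation F /
    (globalDim C ^ ((h₂ : ℤ) - (h₁ : ℤ)) *
      (globalDim D * (kirbyColourImage F).transparentPart.dim) ^ h₁)

namespace KirbyDiagram

variable {h₁ h₂ : ℕ} (K : KirbyDiagram h₁ h₂) (F : C ⥤ D)

/-- The objects `F(X_j)` on the 2-handles for an object labelling `X`. -/
abbrev objects (X : Fin h₂ → Irr C) : Fin h₂ → D := fun j => F.obj (simple (X j))

/-- A choice of dual bases of `D(F(X_1) ⊗ ⋯ ⊗ F(X_N), 𝟙_)` and `D(𝟙_, F(X_1) ⊗ ⋯ ⊗ F(X_N))`, for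
every object labelling and every 1-handle, where the `X_i` are the labels of the strands entering
the `+`-ball, the objects on downward strands being dualised. -/
abbrev BasisChoice : Type _ :=
  ∀ (X : Fin h₂ → Irr C) (a : Fin h₁), DualBases ((K.foot a).obj (objects F X))

variable {K F}

/-- A morphism labelling for the object labelling `X`: a basis element for every 1-handle. -/
abbrev MorphismLabelling (B : K.BasisChoice F) (X : Fin h₂ → Irr C) : Type :=
  ∀ a : Fin h₁, Fin (B X a).card

/-- The morphisms in the balls: the chosen basis morphism in the `+`-ball, the corresponding dual
morphism in the `-`-ball. -/
def ballMorphism (B : K.BasisChoice F) (X : Fin h₂ → Irr C) (s : MorphismLabelling B X) :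
    ∀ b : (ballSig K.foot).Box, ((ballSig K.foot).dom b).obj (objects F X) ⟶
      ((ballSig K.foot).cod b).obj (objects F X)
  | (a, true) => (B X a).basis (s a)
  | (a, false) => (B X a).dual (s a)

/-- The evaluation `⟨K(F)⟩`: the sum over all object labellings and morphism labellings of
`∏_j dim(X_j)` times the value of the labelled diagram. -/
def evaluation [BraidedCategory D] (B : K.BasisChoice F) : ℂ :=
  ∑ X : Fin h₂ → Irr C, ∑ s : MorphismLabelling B X,
    (∏ j, dim (simple (X j))) * scalar (K.diagram.eval (objects F X) (ballMorphism B X s))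

end KirbyDiagram

end Invariant

end Dichromatic

end

noncomputable section

set_option linter.unusedSectionVars false

/-! Both evaluations come from one diagram `G` in which every 1-handle is a coupon. Filling each
coupon with two facing balls gives `K` up to isotopy; filling it with a circle around the strands
gives `L` up to isotopy. Evaluation in a ribbon category is an isotopy invariant
(`Diagram.Isotopic.eval_eq`), so only the morphisms placed in the coupons have to be compared.

The comparison is the killing property `killing_eq_sum`: a circle of colour `Ω_D` around an object
`Y` equals `dim Ω_D` times the sum of the maps `Y ⟶ 𝟙_ ⟶ Y` given by dual bases. Its source is a
handle slide (`killing_whiskerRight_comp_monodromy`): a strand may be pulled across a circle of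
Kirby colour. On a simple object the circle acts by a scalar. If the scalar is nonzero, the slide
makes the object transparent, hence isomorphic to the unit by modularity, and on the unit the circle
is worth `dim Ω_D`. So the circle is `dim Ω_D` times the projection onto the unit-isotypic part.

The slide follows from semisimplicity: `W ⊗ Z` is decomposed into simple objects `V`, and bending
strands turns these decompositions, weighted by dimensions, into a decomposition of `ᘁV ⊗ W`
(`sum_dim_smul_bendIn_comp_bendOut`).

Each coupon occurs exactly once in `G`, so its evaluation is multilinear and the killing property
applies at all 1-handles simultaneously. This gives `⟨L⟩ = (dim Ω_D)^h₁ ⟨K(F)⟩`. The power cancels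
because dimensions are real and not all zero (`globalDim_ne_zero`), and modularity identifies `dim
(FΩ_C)'` with the multiplicity of the unit. -/

namespace Dichromatic

/-! ### Comparison of two duals of one object -/

section DualIso

variable {C : Type u₁} [Category.{v₁} C] [MonoidalCategory C]

theorem whiskerLeft_leftDualIso_comp_evaluation {X₁ X₂ Y : C} (p₁ : ExactPairing X₁ Y)
    (p₂ : ExactPairing X₂ Y) :
    Y ◁ (leftDualIso p₁ p₂).hom ≫ ExactPairing.evaluation X₂ Y =
      ExactPairing.evaluation X₁ Y := by
  have := @leftAdjointMate_comp_evaluation C _ _ Y Y ⟨X₂⟩ ⟨X₁⟩ (𝟙 Y)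
  rw [id_whiskerRight, Category.id_comp] at this
  exact this

theorem coevaluation_comp_leftDualIso_whiskerRight {X₁ X₂ Y : C} (p₁ : ExactPairing X₁ Y)
    (p₂ : ExactPairing X₂ Y) :
    ExactPairing.coevaluation X₁ Y ≫ (leftDualIso p₁ p₂).hom ▷ Y =
      ExactPairing.coevaluation X₂ Y := by
  have := @coevaluation_comp_leftAdjointMate C _ _ Y Y ⟨X₂⟩ ⟨X₁⟩ (𝟙 Y)
  rw [whiskerLeft_id, Category.comp_id] at this
  exact this

end DualIso

/-! ### Duals, traces and tensor products in a pivotal category -/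

section PivotalCalculus

variable {C : Type u₁} [Category.{v₁} C] [MonoidalCategory C] [LeftRigidCategory C]

theorem coevR_comp_whiskerLeft {X Y : C} (f : X ⟶ Y) :
    coevR X ≫ (ᘁX : C) ◁ f = coevR Y ≫ (ᘁf) ▷ Y :=
  (coevaluation_comp_leftAdjointMate f).symm

theorem whiskerLeft_leftAdjointMate_comp_evR {X Y : C} (f : X ⟶ Y) :
    X ◁ (ᘁf) ≫ evR X = f ▷ (ᘁY : C) ≫ evR Y :=
  leftAdjointMate_comp_evaluation f

/-- The evaluation of `X ⊗ Y` with `ᘁY ⊗ ᘁX`. -/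
def nestedEvR (X Y : C) : (X ⊗ Y) ⊗ ((ᘁY) ⊗ (ᘁX)) ⟶ 𝟙_ C :=
  𝟙 _ ⊗≫ X ◁ (evR Y ▷ (ᘁX : C)) ⊗≫ evR X

/-- The coevaluation of `X ⊗ Y` with `ᘁY ⊗ ᘁX`. -/
def nestedCoevR (X Y : C) : 𝟙_ C ⟶ ((ᘁY) ⊗ (ᘁX)) ⊗ (X ⊗ Y) :=
  coevR Y ⊗≫ ((ᘁY : C) ◁ coevR X) ▷ Y ⊗≫ 𝟙 _

/-- The canonical isomorphism `ᘁY ⊗ ᘁX ≅ ᘁ(X ⊗ Y)`. -/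
def dualTensorIso (X Y : C) : (ᘁY) ⊗ (ᘁX) ≅ (ᘁ(X ⊗ Y) : C) :=
  leftDualIso (ExactPairing.tensor : ExactPairing ((ᘁY) ⊗ (ᘁX)) (X ⊗ Y))
    (HasLeftDual.exact (Y := X ⊗ Y))

theorem dualTensorIso_hom (X Y : C) : (dualTensorIso X Y).hom = dualTensor X Y := by
  simp only [dualTensorIso, leftDualIso, leftAdjointMate, dualTensor,
    ExactPairing.tensor_evaluation, whiskerLeft_id, id_whiskerRight, Category.id_comp]
  congr 4
  change (ᘁ(X ⊗ Y) : C) ◁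
    (𝟙 ((X ⊗ Y) ⊗ ((ᘁY) ⊗ (ᘁX))) ⊗≫ X ◁ (evR Y ▷ (ᘁX : C)) ⊗≫ evR X) = _
  monoidal

theorem whiskerLeft_dualTensor_comp_evR (X Y : C) :
    (X ⊗ Y) ◁ dualTensor X Y ≫ evR (X ⊗ Y) = nestedEvR X Y := by
  rw [← dualTensorIso_hom]
  exact whiskerLeft_leftDualIso_comp_evaluation _ _

theorem nestedCoevR_comp_dualTensor_whiskerRight (X Y : C) :
    nestedCoevR X Y ≫ dualTensor X Y ▷ (X ⊗ Y) = coevR (X ⊗ Y) := by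
  rw [← dualTensorIso_hom]
  exact coevaluation_comp_leftDualIso_whiskerRight (X₁ := (ᘁY) ⊗ (ᘁX)) (Y := X ⊗ Y)
    ExactPairing.tensor HasLeftDual.exact

variable [PivotalCategory C]

/-- The exact pairing of `X` and `ᘁX` given by `coevL X` and `evL X`. -/
@[reducible]
def leftPairing (X : C) : ExactPairing X (ᘁX : C) := exactPairingCongrLeft (pivot X)

theorem coevL_comp_whiskerRight {X Y : C} (f : X ⟶ Y) :
    coevL X ≫ f ▷ (ᘁX : C) = coevL Y ≫ Y ◁ (ᘁf) := by
  have h : (pivot X).inv ≫ f = (ᘁ(ᘁf)) ≫ (pivot Y).inv := by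
    rw [Iso.inv_comp_eq, ← Category.assoc, ← PivotalCategory.pivot_naturality]
    simp
  rw [coevL, Category.assoc, ← comp_whiskerRight, h, comp_whiskerRight, ← Category.assoc,
    ← coevR_comp_whiskerLeft, coevL, Category.assoc, Category.assoc, whisker_exchange]

theorem leftAdjointMate_whiskerRight_comp_evL {X Y : C} (f : X ⟶ Y) :
    (ᘁf) ▷ X ≫ evL X = (ᘁY : C) ◁ f ≫ evL Y := by
  rw [evL, ← Category.assoc, ← whisker_exchange, Category.assoc,
    ← whiskerLeft_leftAdjointMate_comp_evR, evL, ← Category.assoc, ← Category.assoc,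
    ← whiskerLeft_comp, ← whiskerLeft_comp, PivotalCategory.pivot_naturality]

/-- The morphism `g` travels around the closed strand, passing through the dual side as `ᘁg`. -/
theorem trR_comp_comm {X Y : C} (f : X ⟶ Y) (g : Y ⟶ X) : trR (f ≫ g) = trR (g ≫ f) := by
  have h : g ▷ (ᘁX : C) ≫ evR X = Y ◁ (ᘁg) ≫ evR Y :=
    (whiskerLeft_leftAdjointMate_comp_evR g).symm
  rw [trR, comp_whiskerRight, Category.assoc, h, ← whisker_exchange_assoc,
    reassoc_of% (coevL_comp_whiskerRight g).symm, trR, comp_whiskerRight, Category.assoc]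

/-- The coevaluation on the other side of `X ⊗ Y` with `ᘁY ⊗ ᘁX`. -/
def nestedCoevL (X Y : C) : 𝟙_ C ⟶ (X ⊗ Y) ⊗ ((ᘁY) ⊗ (ᘁX)) :=
  coevL X ⊗≫ (X ◁ coevL Y) ▷ (ᘁX : C) ⊗≫ 𝟙 _

theorem coevL_comp_pivot (X : C) : coevL X ≫ (pivot X).hom ▷ (ᘁX : C) = coevR (dual X) := by
  simp [coevL, ← comp_whiskerRight]

theorem nestedCoevL_comp_pivot (X Y : C) :
    nestedCoevL X Y ≫ ((pivot X).hom ⊗ₘ (pivot Y).hom) ▷ ((ᘁY) ⊗ (ᘁX)) =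
      nestedCoevR (dual Y) (dual X) := by
  calc
    _ = coevL X ⊗≫ (X ◁ coevL Y ≫ (pivot X).hom ▷ (Y ⊗ (ᘁY))) ▷ (ᘁX : C) ⊗≫
        ((ᘁ(ᘁX) : C) ◁ ((pivot Y).hom ▷ (ᘁY : C))) ▷ (ᘁX : C) ⊗≫ 𝟙 _ := by
      rw [nestedCoevL, MonoidalCategory.tensorHom_def]
      monoidal
    _ = (coevL X ≫ (pivot X).hom ▷ (ᘁX : C)) ⊗≫
        ((ᘁ(ᘁX) : C) ◁ (coevL Y ≫ (pivot Y).hom ▷ (ᘁY : C))) ▷ (ᘁX : C) ⊗≫ 𝟙 _ := by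
      rw [whisker_exchange]
      monoidal
    _ = _ := by rw [coevL_comp_pivot, coevL_comp_pivot, nestedCoevR]

/-- This is the monoidality of the pivotal structure in terms of coevaluations; it makes dimensions
multiplicative. -/
theorem coevL_tensor (X Y : C) :
    coevL (X ⊗ Y) = nestedCoevL X Y ≫ (X ⊗ Y) ◁ dualTensor X Y := by
  -- By `pivot_tensor` the whiskered map is a tensor product of pivots followed by a canonical
  -- isomorphism. After composing with it only the coevaluations `coevR` remain.
  have hmono : Mono (((pivot (X ⊗ Y)).hom ≫ ᘁ(dualTensor X Y)) ▷ (ᘁ(X ⊗ Y) : C)) := by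
    rw [PivotalCategory.pivot_tensor, ← dualTensorIso_hom (ᘁY : C) (ᘁX)]
    infer_instance
  rw [← cancel_mono (((pivot (X ⊗ Y)).hom ≫ ᘁ(dualTensor X Y)) ▷ (ᘁ(X ⊗ Y) : C))]
  calc
    _ = (coevL (X ⊗ Y) ≫ (pivot (X ⊗ Y)).hom ▷ (ᘁ(X ⊗ Y) : C)) ≫
        (ᘁ(dualTensor X Y)) ▷ (ᘁ(X ⊗ Y) : C) := by simp
    _ = (nestedCoevL X Y ≫ ((pivot X).hom ⊗ₘ (pivot Y).hom) ▷ ((ᘁY) ⊗ (ᘁX))) ≫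
        dualTensor (ᘁY : C) (ᘁX) ▷ ((ᘁY) ⊗ (ᘁX)) ≫
          (ᘁ((ᘁY) ⊗ (ᘁX)) : C) ◁ dualTensor X Y := by
      rw [coevL_comp_pivot, ← coevR_comp_whiskerLeft, nestedCoevL_comp_pivot,
        reassoc_of% nestedCoevR_comp_dualTensor_whiskerRight]
    _ = _ := by
      rw [PivotalCategory.pivot_tensor, Category.assoc, Category.assoc, whisker_exchange,
        comp_whiskerRight, Category.assoc]

theorem trR_id_tensor (X Y : C) :
    trR (𝟙 (X ⊗ Y)) = coevL X ⊗≫ (X ◁ trR (𝟙 Y)) ▷ (ᘁX : C) ⊗≫ evR X := by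
  rw [trR, coevL_tensor, id_whiskerRight, Category.id_comp, Category.assoc,
    whiskerLeft_dualTensor_comp_evR, nestedCoevL, nestedEvR, trR, id_whiskerRight,
    Category.id_comp]
  monoidal

end PivotalCalculus

/-! ### A coevaluation determines its evaluation -/

section Uniqueness

variable {C : Type u₁} [Category.{v₁} C] [MonoidalCategory C]

/-- A zigzag of the first pairing is inserted in front of `ε₂`; after an interchange, the shared
coevaluation and `ε₂` form a zigzag of the second pairing, and `ε₁` is left. -/
theorem evaluation_eq_of_coevaluation_eq {X Y : C} (p₁ p₂ : ExactPairing X Y)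
    (h : @ExactPairing.coevaluation _ _ _ X Y p₁ = @ExactPairing.coevaluation _ _ _ X Y p₂) :
    @ExactPairing.evaluation _ _ _ X Y p₁ = @ExactPairing.evaluation _ _ _ X Y p₂ := by
  have h₁ := @ExactPairing.coevaluation_evaluation'' _ _ _ X Y p₁
  have h₂ := @ExactPairing.evaluation_coevaluation'' _ _ _ X Y p₂
  rw [← h] at h₂
  generalize @ExactPairing.coevaluation _ _ _ X Y p₁ = η at *
  generalize @ExactPairing.evaluation _ _ _ X Y p₁ = ε₁ at *
  generalize @ExactPairing.evaluation _ _ _ X Y p₂ = ε₂ at *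
  symm
  calc
    ε₂ = 𝟙 _ ⊗≫ (⊗𝟙.hom : Y ⊗ 𝟙_ C ⟶ 𝟙_ C ⊗ Y) ▷ X ⊗≫ ε₂ := by monoidal
    _ = 𝟙 _ ⊗≫ Y ◁ η ▷ X ⊗≫ (ε₁ ▷ (Y ⊗ X) ≫ 𝟙_ C ◁ ε₂) ⊗≫ 𝟙 _ := by
      rw [← h₁]; monoidal
    _ = 𝟙 _ ⊗≫ Y ◁ (η ▷ X ⊗≫ X ◁ ε₂) ⊗≫ ε₁ := by
      rw [← whisker_exchange]; monoidal
    _ = ε₁ := by rw [h₂]; monoidal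

end Uniqueness

/-! ### Curls closed by a braided coevaluation -/

section BraidedCurl

variable {D : Type u₂} [Category.{v₂} D] [MonoidalCategory D] [BraidedCategory D]

/-- The two crossings combine, by the hexagon, into one crossing past the evaluation, which slides
off and leaves a zigzag. Whatever endomorphism was inserted in the coevaluation survives; below it
is a twist, so curls compute twists. -/
theorem curl_braiding {A' A : D} [ExactPairing A' A] (f : A ⟶ A) :
    (ρ_ A).inv ≫ A ◁ (η_ A' A ≫ (β_ A' A).hom ≫ f ▷ A') ≫ (α_ A A A').inv ≫
      (β_ A A).hom ▷ A' ≫ (α_ A A A').hom ≫ A ◁ ε_ A' A ≫ (ρ_ A).hom = f := by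
  have h1 : A ◁ (β_ A' A).hom ≫ (α_ A A A').inv ≫ (β_ A A).hom ▷ A' ≫ (α_ A A A').hom ≫
      A ◁ ε_ A' A = (α_ A A' A).inv ≫ ε_ A' A ▷ A ≫ (β_ (𝟙_ D) A).hom := by
    rw [BraidedCategory.braiding_naturality_left, BraidedCategory.braiding_tensor_left_hom]
    simp
  have h2 : A ◁ f ▷ A' ≫ (α_ A A A').inv ≫ (β_ A A).hom ▷ A' ≫ (α_ A A A').hom ≫
      A ◁ ε_ A' A ≫ (ρ_ A).hom = (α_ A A A').inv ≫ (β_ A A).hom ▷ A' ≫ (α_ A A A').hom ≫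
      A ◁ ε_ A' A ≫ (ρ_ A).hom ≫ f := by
    have : A ◁ ε_ A' A ≫ (ρ_ A).hom ≫ f = f ▷ (A ⊗ A') ≫ A ◁ ε_ A' A ≫ (ρ_ A).hom := by
      rw [← whisker_exchange_assoc]; simp
    rw [this]
    have h3 : A ◁ f ▷ A' ≫ (α_ A A A').inv ≫ (β_ A A).hom ▷ A' =
      (α_ A A A').inv ≫ (β_ A A).hom ▷ A' ≫ f ▷ A ▷ A' := by
      rw [associator_inv_naturality_middle_assoc, ← comp_whiskerRight,
        BraidedCategory.braiding_naturality_right, comp_whiskerRight]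
    rw [reassoc_of% h3]; simp
  simp only [whiskerLeft_comp, Category.assoc]
  rw [h2, reassoc_of% h1, reassoc_of% (ExactPairing.coevaluation_evaluation A' A)]
  simp

theorem curl_braiding_inv {A' A : D} [ExactPairing A' A] (f : A ⟶ A) :
    (ρ_ A).inv ≫ A ◁ (η_ A' A ≫ (β_ A A').inv ≫ f ▷ A') ≫ (α_ A A A').inv ≫
      (β_ A A).inv ▷ A' ≫ (α_ A A A').hom ≫ A ◁ ε_ A' A ≫ (ρ_ A).hom = f := by
  have h1 : A ◁ (β_ A A').inv ≫ (α_ A A A').inv ≫ (β_ A A).inv ▷ A' ≫ (α_ A A A').hom ≫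
      A ◁ ε_ A' A = (α_ A A' A).inv ≫ ε_ A' A ▷ A ≫ (β_ A (𝟙_ D)).inv := by
    rw [BraidedCategory.braiding_inv_naturality_left, BraidedCategory.braiding_tensor_right_inv]
    simp
  have h2 : A ◁ f ▷ A' ≫ (α_ A A A').inv ≫ (β_ A A).inv ▷ A' ≫ (α_ A A A').hom ≫
      A ◁ ε_ A' A ≫ (ρ_ A).hom = (α_ A A A').inv ≫ (β_ A A).inv ▷ A' ≫ (α_ A A A').hom ≫
      A ◁ ε_ A' A ≫ (ρ_ A).hom ≫ f := by
    have : A ◁ ε_ A' A ≫ (ρ_ A).hom ≫ f = f ▷ (A ⊗ A') ≫ A ◁ ε_ A' A ≫ (ρ_ A).hom := by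
      rw [← whisker_exchange_assoc]; simp
    rw [this]
    have h3 : A ◁ f ▷ A' ≫ (α_ A A A').inv ≫ (β_ A A).inv ▷ A' =
      (α_ A A A').inv ≫ (β_ A A).inv ▷ A' ≫ f ▷ A ▷ A' := by
      rw [associator_inv_naturality_middle_assoc, ← comp_whiskerRight,
        BraidedCategory.braiding_inv_naturality_right, comp_whiskerRight]
    rw [reassoc_of% h3]; simp
  simp only [whiskerLeft_comp, Category.assoc]
  rw [h2, reassoc_of% h1, reassoc_of% (ExactPairing.coevaluation_evaluation A' A)]
  simp

end BraidedCurl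

/-! ### Left and right duality in a ribbon category -/

section Ribbon

variable {D : Type u₂} [Category.{v₂} D] [MonoidalCategory D] [LeftRigidCategory D]
  [BraidedCategory D] [PivotalCategory D] [RibbonCategory D]

/-- The twist of a ribbon category. -/
abbrev twist (X : D) : X ≅ X := RibbonCategory.twist X

theorem twist_eq_curl_coevL (X : D) : (twist X).hom =
    (ρ_ X).inv ≫ X ◁ coevL X ≫ (α_ _ _ _).inv ≫ (β_ X X).hom ▷ (ᘁX) ≫
      (α_ _ _ _).hom ≫ X ◁ evR X ≫ (ρ_ _).hom := by
  have h : X ◁ (pivot X).inv ▷ (ᘁX : D) ≫ (α_ X X (ᘁX)).inv ≫ (β_ X X).hom ▷ (ᘁX : D) =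
      (α_ _ _ _).inv ≫ (β_ X (ᘁ(ᘁX) : D)).hom ▷ (ᘁX : D) ≫ ((pivot X).inv ▷ X) ▷ (ᘁX : D) := by
    rw [associator_inv_naturality_middle_assoc, ← comp_whiskerRight,
      BraidedCategory.braiding_naturality_right, comp_whiskerRight]
  rw [RibbonCategory.twist_eq_curl, coevL, whiskerLeft_comp]
  simp only [Category.assoc]
  rw [reassoc_of% h, associator_naturality_left_assoc, ← whisker_exchange_assoc]
  simp

/-- Bending `ᘁX` to the other side turns a coevaluation `c`, composed with the inverse braiding,
into the curl built from `c`. For `coevL` this curl is the twist, and bending is injective. -/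
theorem coevL_eq_coevR_braiding (X : D) :
    coevL X = coevR X ≫ (β_ (ᘁX : D) X).hom ≫ (twist X).hom ▷ (ᘁX : D) := by
  have h1 : ∀ c : 𝟙_ D ⟶ X ⊗ (ᘁX),
      (tensorLeftHomEquiv (𝟙_ D) (ᘁX : D) X X).symm (c ≫ (β_ (ᘁX : D) X).inv) =
      (ρ_ X).hom ≫ (ρ_ X).inv ≫ X ◁ c ≫ (α_ _ _ _).inv ≫ (β_ X X).hom ▷ (ᘁX) ≫
        (α_ _ _ _).hom ≫ X ◁ evR X ≫ (ρ_ _).hom := by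
    intro c
    have h1 : (α_ X X (ᘁX)).inv ≫ (β_ X X).hom ▷ (ᘁX) ≫ (α_ X X (ᘁX)).hom ≫
        X ◁ evR X = X ◁ (β_ (ᘁX) X).inv ≫ (α_ X (ᘁX) X).inv ≫ evR X ▷ X ≫
          (β_ (𝟙_ D) X).hom := by
      rw [BraidedCategory.braiding_naturality_left, BraidedCategory.braiding_tensor_left_hom]
      simp
    rw [reassoc_of% h1]
    simp [tensorLeftHomEquiv, evR]
  have h2 : coevL X ≫ (β_ (ᘁX : D) X).inv = coevR X ≫ (ᘁX : D) ◁ (twist X).hom := by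
    rw [← (tensorLeftHomEquiv (𝟙_ D) (ᘁX : D) X X).symm.injective.eq_iff, h1,
      ← twist_eq_curl_coevL]
    exact (tensorLeftHomEquiv_symm_coevaluation_comp_whiskerLeft _).symm
  rw [Iso.comp_inv_eq, Category.assoc, BraidedCategory.braiding_naturality_right] at h2
  exact h2

/-- Balance and naturality along the unitor make this twist idempotent, and it is invertible. -/
theorem twist_unit : (twist (𝟙_ D)).hom = 𝟙 (𝟙_ D) := by
  have h := RibbonCategory.balance (𝟙_ D) (𝟙_ D)
  have hn := RibbonCategory.twist_naturality (λ_ (𝟙_ D)).hom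
  rw [h] at hn
  have h' : (twist (𝟙_ D)).hom = (twist (𝟙_ D)).hom ≫ (twist (𝟙_ D)).hom := by
    rw [← cancel_epi (λ_ (𝟙_ D)).hom, hn]
    simp [MonoidalCategory.tensorHom_def, unitors_equal, unitors_inv_equal]
  rw [← cancel_epi (twist (𝟙_ D)).hom, ← h', Category.comp_id]

theorem leftAdjointMate_twist_inv (X : D) : (ᘁ((twist X).inv)) = (twist (ᘁX : D)).inv := by
  rw [← cancel_mono (twist (ᘁX : D)).hom, Iso.inv_hom_id, RibbonCategory.ribbon,
    ← comp_leftAdjointMate, Iso.hom_inv_id, leftAdjointMate_id]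

/-- The twist of `ᘁ(ᘁX) ⊗ ᘁX` is invisible on a coevaluation, since it can be moved to the unit.
Expanding it by the balance equation gives exactly the difference between the two sides. -/
theorem coevL_dual (X : D) :
    coevL (dual X) = coevR X ≫ (ᘁX : D) ◁ (pivot X).hom := by
  have h1 : coevR (dual X) ≫ (twist ((ᘁ(ᘁX)) ⊗ (ᘁX) : D)).hom = coevR (dual X) := by
    rw [RibbonCategory.twist_naturality, twist_unit, Category.id_comp]
  have h2 : (coevR X ≫ (ᘁX : D) ◁ (pivot X).hom) ≫ (β_ (ᘁX : D) (ᘁ(ᘁX) : D)).hom ≫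
      (twist (ᘁ(ᘁX) : D)).hom ▷ (ᘁX : D) = coevR (dual X) := by
    rw [Category.assoc, BraidedCategory.braiding_naturality_right_assoc, ← comp_whiskerRight,
      RibbonCategory.twist_naturality, comp_whiskerRight,
      ← reassoc_of% coevL_eq_coevR_braiding X, coevL_comp_pivot]
  rw [← cancel_mono ((β_ (ᘁX : D) (ᘁ(ᘁX) : D)).hom ≫ (twist (ᘁ(ᘁX) : D)).hom ▷ (ᘁX : D)), h2,
    coevL_eq_coevR_braiding]
  refine Eq.trans ?_ h1
  rw [RibbonCategory.balance, MonoidalCategory.tensorHom_def]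
  simp only [Category.assoc]
  rw [BraidedCategory.braiding_naturality_left_assoc,
    BraidedCategory.braiding_naturality_right_assoc,
    BraidedCategory.braiding_naturality_left,
    BraidedCategory.braiding_naturality_left_assoc,
    BraidedCategory.braiding_naturality_right_assoc, whisker_exchange]

theorem coevR_eq_coevL_braiding (X : D) :
    coevR X = coevL X ≫ (β_ X (ᘁX : D)).hom ≫ (twist (ᘁX : D)).hom ▷ X := by
  have h1 := coevL_eq_coevR_braiding (dual X)
  rw [coevL_dual] at h1
  have h2 : (pivot X).inv ▷ (ᘁX : D) ≫ (β_ X (ᘁX)).hom =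
    (β_ (ᘁ(ᘁX) : D) (ᘁX)).hom ≫ (ᘁX : D) ◁ (pivot X).inv :=
    BraidedCategory.braiding_naturality_left _ _
  rw [coevL, Category.assoc, reassoc_of% h2, whisker_exchange]
  rw [← reassoc_of% h1]
  simp

theorem coevL_eq_coevR_braiding_inv (X : D) :
    coevL X = coevR X ≫ (β_ X (ᘁX : D)).inv ≫ (twist X).inv ▷ (ᘁX : D) := by
  have h : coevR X ≫ (twist (ᘁX : D)).inv ▷ X = coevL X ≫ (β_ X (ᘁX : D)).hom := by
    rw [coevR_eq_coevL_braiding X]; simp [← comp_whiskerRight]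
  rw [← leftAdjointMate_twist_inv, ← coevR_comp_whiskerLeft] at h
  rw [← BraidedCategory.braiding_inv_naturality_right, ← Category.assoc, h]
  simp

theorem coevR_eq_coevL_braiding_inv (X : D) :
    coevR X = coevL X ≫ (β_ (ᘁX : D) X).inv ≫ (twist (ᘁX : D)).inv ▷ X := by
  have h : coevL X ≫ (twist X).inv ▷ (ᘁX : D) = coevR X ≫ (β_ (ᘁX : D) X).hom := by
    rw [coevL_eq_coevR_braiding X]; simp [← comp_whiskerRight]
  rw [coevL_comp_whiskerRight, leftAdjointMate_twist_inv] at h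
  rw [← BraidedCategory.braiding_inv_naturality_right, ← Category.assoc, h]
  simp

/-- The braided and twisted form of the right pairing has `coevL X` as its coevaluation, so its
evaluation must be `evL X`. -/
theorem evL_eq_braiding_evR (X : D) :
    evL X = (ᘁX : D) ◁ (twist X).hom ≫ (β_ (ᘁX : D) X).hom ≫ evR X := by
  let := BraidedCategory.exactPairing_swap (ᘁX : D) X
  refine evaluation_eq_of_coevaluation_eq (leftPairing X)
    (exactPairingCongrLeft (twist X)) ?_
  change coevL X = (coevR X ≫ (β_ X (ᘁX : D)).inv) ≫ (twist X).inv ▷ (ᘁX : D)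
  rw [coevL_eq_coevR_braiding_inv, Category.assoc]

/-- In terms of `coevR` and `evR` both closures consist of one braiding and one twist. -/
theorem trL_id (X : D) : trL (𝟙 X) = trR (𝟙 X) := by
  have h : (ᘁX : D) ◁ (twist X).hom ≫ (β_ (ᘁX : D) X).hom =
    (β_ (ᘁX : D) X).hom ≫ (twist X).hom ▷ (ᘁX : D) :=
    BraidedCategory.braiding_naturality_right _ _
  rw [trL, trR, whiskerLeft_id, id_whiskerRight, Category.id_comp, Category.id_comp,
    evL_eq_braiding_evR, coevL_eq_coevR_braiding, reassoc_of% h]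
  simp

theorem trR_id_dual (X : D) : trR (𝟙 (ᘁX : D)) = trR (𝟙 X) := by
  rw [← trL_id X, trR, trL, whiskerLeft_id, id_whiskerRight, Category.id_comp,
    Category.id_comp]
  have := coevL_dual X
  dsimp only [dual] at this
  rw [this, Category.assoc, evL]

theorem twist_whiskerRight_comp_evR (X : D) :
    (twist X).hom ▷ (ᘁX : D) ≫ evR X = X ◁ (twist (ᘁX : D)).hom ≫ evR X := by
  rw [RibbonCategory.ribbon, whiskerLeft_leftAdjointMate_comp_evR]

theorem twist_whiskerRight_comp_evL (X : D) :
    (twist (ᘁX : D)).hom ▷ X ≫ evL X = (ᘁX : D) ◁ (twist X).hom ≫ evL X := by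
  rw [RibbonCategory.ribbon, leftAdjointMate_whiskerRight_comp_evL]

end Ribbon

/-! ### Isotopy invariance of the evaluation -/

section DiagramEvaluation

variable {D : Type u₂} [Category.{v₂} D] [MonoidalCategory D] [LeftRigidCategory D]
  [BraidedCategory D] [PivotalCategory D] [RibbonCategory D] {ι : Type} {S : BoxSig ι}
  (X : ι → D) (φ : ∀ b, (S.dom b).obj X ⟶ (S.cod b).obj X)

namespace Diagram

/-- A downward strand is closed with `coevR` and `evL`. Its curl therefore needs `coevR` written
through `coevL`, for the exact pairing of `X j` with its dual on the other side. -/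
theorem eval_curl (j : ι) (b : Bool) :
    (curl (S := S) j b).eval X φ = (twist ((Word.strand j b).obj X)).hom := by
  cases b
  · change (ρ_ (ᘁ(X j) : D)).inv ≫ (𝟙 _ ⊗ₘ coevR (X j)) ≫ (α_ _ _ _).inv ≫
      ((β_ (ᘁ(X j) : D) (ᘁ(X j))).hom ⊗ₘ 𝟙 _) ≫ (α_ _ _ _).hom ≫ (𝟙 _ ⊗ₘ evL (X j)) ≫
      (ρ_ _).hom = (twist (ᘁ(X j) : D)).hom
    let := leftPairing (X j)
    rw [coevR_eq_coevL_braiding, id_tensorHom, tensorHom_id, id_tensorHom]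
    exact curl_braiding (A' := X j) (A := (ᘁ(X j) : D)) _
  · change (ρ_ (X j)).inv ≫ (𝟙 _ ⊗ₘ coevL (X j)) ≫ (α_ _ _ _).inv ≫
      ((β_ (X j) (X j)).hom ⊗ₘ 𝟙 _) ≫ (α_ _ _ _).hom ≫ (𝟙 _ ⊗ₘ evR (X j)) ≫
      (ρ_ _).hom = (twist (X j)).hom
    rw [coevL_eq_coevR_braiding, id_tensorHom, tensorHom_id, id_tensorHom]
    exact curl_braiding _

theorem eval_curlInv (j : ι) (b : Bool) :
    (curlInv (S := S) j b).eval X φ = (twist ((Word.strand j b).obj X)).inv := by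
  cases b
  · change (ρ_ (ᘁ(X j) : D)).inv ≫ (𝟙 _ ⊗ₘ coevR (X j)) ≫ (α_ _ _ _).inv ≫
      ((β_ (ᘁ(X j) : D) (ᘁ(X j))).inv ⊗ₘ 𝟙 _) ≫ (α_ _ _ _).hom ≫ (𝟙 _ ⊗ₘ evL (X j)) ≫
      (ρ_ _).hom = (twist (ᘁ(X j) : D)).inv
    let := leftPairing (X j)
    rw [coevR_eq_coevL_braiding_inv, id_tensorHom, tensorHom_id, id_tensorHom]
    exact curl_braiding_inv (A' := X j) (A := (ᘁ(X j) : D)) _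
  · change (ρ_ (X j)).inv ≫ (𝟙 _ ⊗ₘ coevL (X j)) ≫ (α_ _ _ _).inv ≫
      ((β_ (X j) (X j)).inv ⊗ₘ 𝟙 _) ≫ (α_ _ _ _).hom ≫ (𝟙 _ ⊗ₘ evR (X j)) ≫
      (ρ_ _).hom = (twist (X j)).inv
    rw [coevL_eq_coevR_braiding_inv, id_tensorHom, tensorHom_id, id_tensorHom]
    exact curl_braiding_inv _

theorem eval_fullTwist (V : Word ι) :
    (fullTwist (S := S) V).eval X φ = (twist (V.obj X)).hom := by
  induction V with
  | unit => simp [fullTwist, eval, Word.obj, twist_unit]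
  | strand j b => exact eval_curl X φ j b
  | tensor V W hV hW =>
    simp only [fullTwist, eval, hV, hW, Piece.eval, Word.obj, RibbonCategory.balance]

/-- Each generating move is an axiom of ribbon categories or a zigzag identity once curls and full
twists are known to evaluate to twists; full rotation is then naturality of the twist. -/
theorem Isotopic.eval_eq {V W : Word ι} {f g : Diagram S V W} (h : Isotopic f g) :
    f.eval X φ = g.eval X φ := by
  induction h with
  | refl => rfl
  | symm _ ih => exact ih.symm
  | trans _ _ ih₁ ih₂ => exact ih₁.trans ih₂
  | comp _ _ ih₁ ih₂ => simp only [eval, ih₁, ih₂]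
  | tensor _ _ ih₁ ih₂ => exact congrArg₂ (· ⊗ₘ ·) ih₁ ih₂
  | curl_curlInv j b =>
    simp only [eval, eval_curl, eval_curlInv, Iso.hom_inv_id]
  | curlInv_curl j b =>
    simp only [eval, eval_curl, eval_curlInv, Iso.inv_hom_id]
  | curl_cap j b =>
    cases b
    · simp only [eval, eval_curl]
      change ((twist (ᘁ(X j) : D)).hom ⊗ₘ 𝟙 _) ≫ evL (X j) =
        (𝟙 _ ⊗ₘ (twist (X j)).hom) ≫ evL (X j)
      rw [tensorHom_id, id_tensorHom, twist_whiskerRight_comp_evL]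
    · simp only [eval, eval_curl]
      change ((twist (X j)).hom ⊗ₘ 𝟙 _) ≫ evR (X j) =
        (𝟙 _ ⊗ₘ (twist (ᘁ(X j) : D)).hom) ≫ evR (X j)
      rw [tensorHom_id, id_tensorHom, twist_whiskerRight_comp_evR]
  | fullTwist_naturality f =>
    simp only [eval, eval_fullTwist, RibbonCategory.twist_naturality]
  | zigzag_left j =>
    change (λ_ (X j)).inv ≫ (coevL (X j) ⊗ₘ 𝟙 _) ≫ (α_ _ _ _).hom ≫
      (𝟙 _ ⊗ₘ evL (X j)) ≫ (ρ_ _).hom = 𝟙 (X j)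
    have := @ExactPairing.evaluation_coevaluation_assoc _ _ _ _ _ (leftPairing (X j))
    rw [id_tensorHom, tensorHom_id]
    refine (congrArg _ (this _)).trans ?_
    simp
  | zigzag_right j =>
    change (ρ_ (X j)).inv ≫ (𝟙 _ ⊗ₘ coevR (X j)) ≫ (α_ _ _ _).inv ≫
      (evR (X j) ⊗ₘ 𝟙 _) ≫ (λ_ _).hom = 𝟙 (X j)
    have := @ExactPairing.coevaluation_evaluation_assoc _ _ _ (ᘁ(X j) : D) (X j) _
    rw [id_tensorHom, tensorHom_id]
    refine (congrArg _ (this _)).trans ?_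
    simp
  | zigzag_left' j =>
    change (λ_ (ᘁ(X j) : D)).inv ≫ (coevR (X j) ⊗ₘ 𝟙 _) ≫ (α_ _ _ _).hom ≫
      (𝟙 _ ⊗ₘ evR (X j)) ≫ (ρ_ _).hom = 𝟙 (ᘁ(X j) : D)
    have := @ExactPairing.evaluation_coevaluation_assoc _ _ _ (ᘁ(X j) : D) (X j) _
    rw [id_tensorHom, tensorHom_id]
    refine (congrArg _ (this _)).trans ?_
    simp
  | zigzag_right' j =>
    change (ρ_ (ᘁ(X j) : D)).inv ≫ (𝟙 _ ⊗ₘ coevL (X j)) ≫ (α_ _ _ _).inv ≫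
      (evL (X j) ⊗ₘ 𝟙 _) ≫ (λ_ _).hom = 𝟙 (ᘁ(X j) : D)
    have := @ExactPairing.coevaluation_evaluation_assoc _ _ _ _ _ (leftPairing (X j))
    rw [id_tensorHom, tensorHom_id]
    refine (congrArg _ (this _)).trans ?_
    simp
  | braid_naturality f g => exact BraidedCategory.braiding_naturality _ _
  | hexagon_forward X Y Z => simp [eval, Piece.eval, Word.obj]
  | hexagon_reverse X Y Z => simp [eval, Piece.eval, Word.obj]
  | _ => simp [eval, Piece.eval, Word.obj]

end Diagram

end DiagramEvaluation

/-! ### Scalars of endomorphisms of simple objects -/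

section Schur

variable {C : Type u₁} [Category.{v₁} C] [Preadditive C] [Linear ℂ C]

theorem IsSimple.id_ne_zero {X : C} (h : IsSimple X) : 𝟙 X ≠ 0 := by
  intro h0
  have hz : ∀ g : X ⟶ X, g = 0 := fun g => by
    rw [← Category.comp_id g, h0, Limits.comp_zero]
  have : Subsingleton (X ⟶ X) := ⟨fun a b => by rw [hz a, hz b]⟩
  have h1 : Module.finrank ℂ (X ⟶ X) = 0 := Module.finrank_zero_of_subsingleton
  rw [IsSimple] at h
  omega

theorem IsSimple.smul_id_injective {X : C} (h : IsSimple X) {c c' : ℂ}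
    (e : c • 𝟙 X = c' • 𝟙 X) : c = c' :=
  smul_left_injective ℂ h.id_ne_zero e

/-- The scalar by which an endomorphism of a simple object acts. -/
def IsSimple.coeff {X : C} (h : IsSimple X) : (X ⟶ X) →ₗ[ℂ] ℂ where
  toFun f := Classical.choose (h.exists_smul_id f)
  map_add' f g := h.smul_id_injective <| by
    rw [← Classical.choose_spec (h.exists_smul_id (f + g)), add_smul,
      ← Classical.choose_spec (h.exists_smul_id f), ← Classical.choose_spec (h.exists_smul_id g)]
  map_smul' c f := h.smul_id_injective <| by
    rw [← Classical.choose_spec (h.exists_smul_id (c • f)), RingHom.id_apply, smul_eq_mul,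
      mul_smul, ← Classical.choose_spec (h.exists_smul_id f)]

theorem IsSimple.coeff_smul_id {X : C} (h : IsSimple X) (f : X ⟶ X) : h.coeff f • 𝟙 X = f :=
  (Classical.choose_spec (h.exists_smul_id f)).symm

theorem IsSimple.coeff_of_eq {X : C} (h : IsSimple X) {f : X ⟶ X} {c : ℂ} (e : f = c • 𝟙 X) :
    h.coeff f = c :=
  h.smul_id_injective (by rw [h.coeff_smul_id, e])

theorem IsSimple.coeff_ne_zero {X : C} (h : IsSimple X) {f : X ⟶ X} (hf : f ≠ 0) :
    h.coeff f ≠ 0 := fun h0 => hf (by rw [← h.coeff_smul_id f, h0, zero_smul])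

theorem IsSimple.coeff_inv_smul {X : C} (h : IsSimple X) {f : X ⟶ X} (hf : f ≠ 0) :
    (h.coeff f)⁻¹ • f = 𝟙 X := by
  obtain ⟨c, rfl⟩ := h.exists_smul_id f
  have hc := h.coeff_ne_zero hf
  rw [h.coeff_of_eq rfl] at hc ⊢
  rw [smul_smul, inv_mul_cancel₀ hc, one_smul]

/-- The pairing of `S ⟶ X` and `X ⟶ S` given by composition, for a simple object `S`. -/
def IsSimple.pairing {S : C} (h : IsSimple S) (X : C) :
    (S ⟶ X) →ₗ[ℂ] (X ⟶ S) →ₗ[ℂ] ℂ :=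
  (Linear.comp S X S).compr₂ h.coeff

theorem IsSimple.pairing_smul_id {S : C} (h : IsSimple S) {X : C} (q : S ⟶ X) (p : X ⟶ S) :
    h.pairing X q p • 𝟙 S = q ≫ p :=
  h.coeff_smul_id _

end Schur

/-! ### Semisimplicity: Schur's lemma, dual bases, resolutions of the identity -/

section Fusion

variable {D : Type u₂} [Category.{v₂} D] [Preadditive D] [Linear ℂ D]
  [MonoidalCategory D] [MonoidalPreadditive D] [MonoidalLinear ℂ D]
  [LeftRigidCategory D] [FusionCategory D]

theorem mem_span_comp_simple {X Y : D} (f : X ⟶ Y) :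
    f ∈ Submodule.span ℂ
      {g : X ⟶ Y | ∃ (Z : Irr D) (p : X ⟶ simple Z) (q : simple Z ⟶ Y), g = p ≫ q} := by
  obtain ⟨t, rfl⟩ := (FusionCategory.bijective_composition X Y).2 f
  rw [composition, LinearMap.sum_apply]
  refine Submodule.sum_mem _ fun i _ => ?_
  simp only [LinearMap.comp_apply, LinearMap.proj_apply]
  induction t i with
  | zero => simp
  | tmul p q => exact Submodule.subset_span ⟨i, p, q, rfl⟩
  | add a b ha hb => rw [map_add]; exact Submodule.add_mem _ ha hb

/-- A linear condition on morphisms may be checked on those that factor through a simple object. -/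
theorem simple_induction {X Y : D} {P : (X ⟶ Y) → Prop} (f : X ⟶ Y)
    (comp : ∀ (Z : Irr D) (p : X ⟶ simple Z) (q : simple Z ⟶ Y), P (p ≫ q))
    (zero : P 0) (add : ∀ a b, P a → P b → P (a + b)) (smul : ∀ (c : ℂ) a, P a → P (c • a)) :
    P f := by
  refine Submodule.span_induction (p := fun g _ => P g) ?_ zero (fun a b _ _ => add a b)
    (fun c a _ => smul c a) (mem_span_comp_simple f)
  rintro _ ⟨Z, p, q, rfl⟩
  exact comp Z p q

theorem isSimple_simple (Z : Irr D) : IsSimple (simple Z) := FusionCategory.isSimple Z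

/-- The tensors `𝟙 ⊗ f` in slot `Z` and `f ⊗ 𝟙` in slot `Z'` both compose to `f`. Injectivity of
`composition` identifies them, although they live in different slots, so both vanish. -/
theorem hom_simple_eq_zero {Z Z' : Irr D} (h : Z ≠ Z') (f : simple Z ⟶ simple Z') : f = 0 := by
  classical
  have hc : ∀ (i : Irr D) (t : TensorProduct ℂ (simple Z ⟶ simple i) (simple i ⟶ simple Z')),
      composition FusionCategory.simple (simple Z) (simple Z') (Pi.single i t) =
        TensorProduct.lift (Linear.comp (simple Z) (simple i) (simple Z')) t := by
    intro i t
    rw [composition, LinearMap.sum_apply, Finset.sum_eq_single i]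
    · simp
    · intro j _ hj
      simp [Pi.single_eq_of_ne hj]
    · simp
  have h1 := (FusionCategory.bijective_composition (simple Z) (simple Z')).1
    ((hc Z (TensorProduct.tmul ℂ (𝟙 _) f)).trans
      (Eq.trans (by simp [Linear.comp]) (hc Z' (TensorProduct.tmul ℂ f (𝟙 _))).symm))
  have h2 := congrFun h1 Z
  rw [Pi.single_eq_same, Pi.single_eq_of_ne h] at h2
  have h3 := congrArg (TensorProduct.lift (Linear.comp (simple Z) (simple Z) (simple Z'))) h2
  simpa [Linear.comp] using h3

/-- The identity is a combination of composites `p ≫ q` through representatives, so some composite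
is nonzero. Then `p ≫ q` and `q ≫ p` are the same nonzero scalar, and `p` is invertible. -/
theorem IsSimple.exists_iso_simple {X : D} (h : IsSimple X) :
    ∃ Z : Irr D, Nonempty (X ≅ simple Z) := by
  by_contra hX
  push Not at hX
  refine h.id_ne_zero (simple_induction (P := fun f => f = 0) (𝟙 X) (fun Z p q => ?_) rfl
    (fun a b ha hb => by rw [ha, hb, add_zero]) (fun c a ha => by rw [ha, smul_zero]))
  by_contra hne
  have hpq := (h.coeff_smul_id (p ≫ q)).symm
  have hqp := ((isSimple_simple Z).coeff_smul_id (q ≫ p)).symm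
  have hp : p ≠ 0 := fun h0 => hne (by rw [h0, Limits.zero_comp])
  have heq : h.coeff (p ≫ q) = (isSimple_simple Z).coeff (q ≫ p) := by
    refine smul_left_injective ℂ hp ?_
    calc
      h.coeff (p ≫ q) • p = (p ≫ q) ≫ p := by
        conv_rhs => rw [hpq]
        simp
      _ = p ≫ (q ≫ p) := Category.assoc _ _ _
      _ = _ := by
        conv_lhs => rw [hqp]
        simp
  refine (hX Z).false ⟨p, (h.coeff (p ≫ q))⁻¹ • q, ?_, ?_⟩
  · rw [Linear.comp_smul, h.coeff_inv_smul hne]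
  · rw [Linear.smul_comp, heq, (isSimple_simple Z).coeff_inv_smul]
    intro h0
    have hpp : p ≫ (q ≫ p) = 0 := by rw [h0, Limits.comp_zero]
    rw [← Category.assoc, hpq, Linear.smul_comp, Category.id_comp] at hpp
    exact (smul_ne_zero (h.coeff_ne_zero hne) hp) hpp

/-- Without a retraction `q` would be annihilated by every map to `S`, and by Schur's lemma by every
map to another simple object. Resolving `𝟙 X` through simple objects then gives `q = 0`. -/
theorem IsSimple.exists_retraction {S X : D} (h : IsSimple S) (q : S ⟶ X) (hq : q ≠ 0) :
    ∃ p : X ⟶ S, q ≫ p = 𝟙 S := by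
  by_contra hX
  push Not at hX
  have hX' : ∀ p : X ⟶ S, q ≫ p = 0 := by
    intro p
    by_contra hne
    exact hX ((h.coeff (q ≫ p))⁻¹ • p) (by rw [Linear.comp_smul, h.coeff_inv_smul hne])
  obtain ⟨Z, ⟨e⟩⟩ := h.exists_iso_simple
  refine hq ?_
  rw [← Category.comp_id q]
  refine simple_induction (P := fun f => q ≫ f = 0) (𝟙 X) (fun W r s => ?_) Limits.comp_zero
    (fun a b ha hb => by rw [Preadditive.comp_add, ha, hb, add_zero])
    (fun c a ha => by rw [Linear.comp_smul, ha, smul_zero])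
  suffices hr : q ≫ r = 0 by rw [← Category.assoc, hr, Limits.zero_comp]
  by_cases hZ : Z = W
  · subst hZ
    have := hX' (r ≫ e.inv)
    rw [← cancel_mono e.inv, Category.assoc, this, Limits.zero_comp]
  · have := hom_simple_eq_zero hZ (e.inv ≫ q ≫ r)
    rw [← cancel_epi e.inv, this, Limits.comp_zero]

theorem IsSimple.exists_section {S X : D} (h : IsSimple S) (p : X ⟶ S) (hp : p ≠ 0) :
    ∃ q : S ⟶ X, q ≫ p = 𝟙 S := by
  by_contra hX
  push Not at hX
  have hX' : ∀ q : S ⟶ X, q ≫ p = 0 := by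
    intro q
    by_contra hne
    exact hX ((h.coeff (q ≫ p))⁻¹ • q) (by rw [Linear.smul_comp, h.coeff_inv_smul hne])
  obtain ⟨Z, ⟨e⟩⟩ := h.exists_iso_simple
  refine hp ?_
  rw [← Category.id_comp p]
  refine simple_induction (P := fun f => f ≫ p = 0) (𝟙 X) (fun W r s => ?_) Limits.zero_comp
    (fun a b ha hb => by rw [Preadditive.add_comp, ha, hb, add_zero])
    (fun c a ha => by rw [Linear.smul_comp, ha, smul_zero])
  suffices hr : s ≫ p = 0 by rw [Category.assoc, hr, Limits.comp_zero]
  by_cases hZ : W = Z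
  · subst hZ
    have := hX' (e.hom ≫ s)
    rw [← cancel_epi e.hom, ← Category.assoc, this, Limits.comp_zero]
  · have := hom_simple_eq_zero hZ ((s ≫ p) ≫ e.hom)
    rw [← cancel_mono e.hom, this, Limits.zero_comp]

theorem IsSimple.pairing_injective {S : D} (h : IsSimple S) (X : D) :
    Function.Injective (h.pairing X) := by
  rw [injective_iff_map_eq_zero]
  intro q hq
  by_contra hne
  obtain ⟨p, hp⟩ := h.exists_retraction q hne
  have := h.pairing_smul_id q p
  rw [hq, LinearMap.zero_apply, zero_smul, hp] at this
  exact h.id_ne_zero this.symm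

theorem IsSimple.pairing_flip_injective {S : D} (h : IsSimple S) (X : D) :
    Function.Injective (h.pairing X).flip := by
  rw [injective_iff_map_eq_zero]
  intro p hp
  by_contra hne
  obtain ⟨q, hq⟩ := h.exists_section p hne
  have := h.pairing_smul_id q p
  rw [← LinearMap.flip_apply, hp, LinearMap.zero_apply, zero_smul, hq] at this
  exact h.id_ne_zero this.symm

theorem IsSimple.finrank_hom_comm {S : D} (h : IsSimple S) (X : D) :
    Module.finrank ℂ (S ⟶ X) = Module.finrank ℂ (X ⟶ S) := by
  refine le_antisymm ?_ ?_
  · rw [← Subspace.dual_finrank_eq (K := ℂ) (V := (X ⟶ S))]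
    exact LinearMap.finrank_le_finrank_of_injective (h.pairing_injective X)
  · rw [← Subspace.dual_finrank_eq (K := ℂ) (V := (S ⟶ X))]
    exact LinearMap.finrank_le_finrank_of_injective (h.pairing_flip_injective X)

theorem IsSimple.exists_dual_basis {S : D} (h : IsSimple S) (X : D) {n : Type*} [Fintype n]
    [DecidableEq n] (p : Module.Basis n ℂ (X ⟶ S)) :
    ∃ q : n → (S ⟶ X), ∀ i j, q i ≫ p j = if i = j then 𝟙 S else 0 := by
  have hb : Function.Bijective (h.pairing X) :=
    (LinearMap.injective_iff_surjective_of_finrank_eq_finrank (by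
      rw [Subspace.dual_finrank_eq, h.finrank_hom_comm])).1 (h.pairing_injective X) |>
      fun hs => ⟨h.pairing_injective X, hs⟩
  choose q hq using fun i => hb.2 (p.coord i)
  refine ⟨q, fun i j => ?_⟩
  rw [← h.pairing_smul_id, hq, Module.Basis.coord_apply, p.repr_self, Finsupp.single_apply]
  simp [eq_comm]

/-- The sum fixes every map from `X` to a member of `S`, and such maps detect equality because `𝟙 X`
is resolved through simple objects. The family `S` is kept general so that it can also consist of
the duals of the chosen representatives. -/
theorem sum_comp_eq_id {X : D} {S : Irr D → D} (hS : ∀ Z : Irr D, ∃ Z', Nonempty (simple Z ≅ S Z'))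
    (hS' : ∀ Z Z' : Irr D, Z ≠ Z' → ∀ f : S Z ⟶ S Z', f = 0) {n : Irr D → Type*}
    [∀ Z, Fintype (n Z)] [∀ Z, DecidableEq (n Z)]
    (p : ∀ Z, n Z → (X ⟶ S Z)) (q : ∀ Z, n Z → (S Z ⟶ X))
    (hp : ∀ Z, Submodule.span ℂ (Set.range (p Z)) = ⊤)
    (hqp : ∀ Z i j, q Z i ≫ p Z j = if i = j then 𝟙 (S Z) else 0) :
    ∑ Z, ∑ i, p Z i ≫ q Z i = 𝟙 X := by
  have h1 : ∀ Z (f : X ⟶ S Z), (∑ Z, ∑ i, p Z i ≫ q Z i) ≫ f = f := by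
    intro Z f
    have hf : f ∈ Submodule.span ℂ (Set.range (p Z)) := by rw [hp]; trivial
    induction hf using Submodule.span_induction with
    | mem f hf =>
      obtain ⟨j, rfl⟩ := hf
      rw [Preadditive.sum_comp, Finset.sum_eq_single Z, Preadditive.sum_comp,
        Finset.sum_eq_single j]
      · rw [Category.assoc, hqp, if_pos rfl, Category.comp_id]
      · intro i _ hi
        rw [Category.assoc, hqp, if_neg hi, Limits.comp_zero]
      · simp
      · intro W _ hW
        rw [Preadditive.sum_comp]
        refine Finset.sum_eq_zero fun i _ => ?_
        rw [Category.assoc, hS' W Z hW (q W i ≫ p Z j), Limits.comp_zero]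
      · simp
    | zero => rw [Limits.comp_zero]
    | add a b _ _ ha hb => rw [Preadditive.comp_add, ha, hb]
    | smul c a _ ha => rw [Linear.comp_smul, ha]
  rw [← Category.comp_id (∑ Z, ∑ i, p Z i ≫ q Z i)]
  refine simple_induction (P := fun f => (∑ Z, ∑ i, p Z i ≫ q Z i) ≫ f = f) (𝟙 X)
    (fun Z a b => ?_) Limits.comp_zero
    (fun a b ha hb => by rw [Preadditive.comp_add, ha, hb])
    (fun c a ha => by rw [Linear.comp_smul, ha])
  obtain ⟨Z', ⟨e⟩⟩ := hS Z
  have := h1 Z' (a ≫ e.hom)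
  have h2 : (∑ Z, ∑ i, p Z i ≫ q Z i) ≫ a = a := by
    rw [← cancel_mono e.hom, Category.assoc, this]
  rw [← Category.assoc, h2]

theorem exists_decomposition (X : D) :
    ∃ (p : ∀ Z : Irr D, Module.Basis (Fin (Module.finrank ℂ (X ⟶ simple Z))) ℂ (X ⟶ simple Z))
      (q : ∀ Z : Irr D, Fin (Module.finrank ℂ (X ⟶ simple Z)) → (simple Z ⟶ X)),
      (∀ Z i j, q Z i ≫ p Z j = if i = j then 𝟙 (simple Z) else 0) ∧
      ∑ Z, ∑ i, p Z i ≫ q Z i = 𝟙 X := by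
  choose q hq using fun Z : Irr D =>
    (isSimple_simple Z).exists_dual_basis X (Module.finBasis ℂ (X ⟶ simple Z))
  exact ⟨fun Z => Module.finBasis ℂ (X ⟶ simple Z), q, hq,
    sum_comp_eq_id (fun Z => ⟨Z, ⟨Iso.refl _⟩⟩) (fun Z Z' h f => hom_simple_eq_zero h f) _ q
      (fun Z => (Module.finBasis ℂ (X ⟶ simple Z)).span_eq) hq⟩

theorem exists_unit_iso : ∃ Z : Irr D, Nonempty (𝟙_ D ≅ simple Z) :=
  (FusionCategory.unit_isSimple (C := D)).exists_iso_simple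

end Fusion

/-! ### Traces, dimensions and the nonvanishing of the global dimension -/

section Trace

variable {D : Type u₂} [Category.{v₂} D] [Preadditive D] [Linear ℂ D]
  [MonoidalCategory D] [MonoidalPreadditive D] [MonoidalLinear ℂ D]
  [LeftRigidCategory D] [FusionCategory D]

variable (D) in
/-- The scalar of an endomorphism of the unit, as a linear map. -/
def scalarₗ : (𝟙_ D ⟶ 𝟙_ D) →ₗ[ℂ] ℂ := (FusionCategory.unit_isSimple (C := D)).coeff

theorem scalarₗ_apply (f : 𝟙_ D ⟶ 𝟙_ D) : scalarₗ D f = scalar f := rfl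

variable [PivotalCategory D]

variable (D) in
/-- The trace as a linear map. -/
def trₗ (X : D) : (X ⟶ X) →ₗ[ℂ] ℂ where
  toFun := tr
  map_add' f g := by
    simp only [tr, trR, MonoidalPreadditive.add_whiskerRight, Preadditive.comp_add,
      Preadditive.add_comp, ← scalarₗ_apply, map_add]
  map_smul' c f := by
    simp only [tr, trR, MonoidalLinear.smul_whiskerRight, Linear.comp_smul, Linear.smul_comp,
      ← scalarₗ_apply, map_smul, RingHom.id_apply]

theorem trₗ_apply {X : D} (f : X ⟶ X) : trₗ D X f = tr f := rfl

theorem tr_comp_comm {X Y : D} (f : X ⟶ Y) (g : Y ⟶ X) : tr (f ≫ g) = tr (g ≫ f) := by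
  rw [tr, trR_comp_comm, tr]

theorem trR_id (X : D) : trR (𝟙 X) = dim X • 𝟙 (𝟙_ D) := scalar_spec _

theorem dim_congr {X Y : D} (e : X ≅ Y) : dim X = dim Y := by
  rw [dim, ← e.hom_inv_id, tr_comp_comm, e.inv_hom_id, dim]

theorem dim_tensor (X Y : D) : dim (X ⊗ Y) = dim X * dim Y := by
  have h : trR (𝟙 (X ⊗ Y)) = dim Y • trR (𝟙 X) := by
    rw [trR_id_tensor, trR_id Y, MonoidalLinear.whiskerLeft_smul, whiskerLeft_id,
      MonoidalLinear.smul_whiskerRight, id_whiskerRight]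
    simp only [monoidalComp, Linear.smul_comp, Linear.comp_smul]
    congr 1
    rw [trR]
    monoidal
  rw [dim, tr, h, ← scalarₗ_apply, map_smul, scalarₗ_apply, smul_eq_mul, mul_comm]
  rfl

theorem dim_eq_sum (X : D) :
    dim X = ∑ Z : Irr D, (Module.finrank ℂ (X ⟶ simple Z) : ℂ) * dim (simple Z) := by
  obtain ⟨p, q, hqp, h⟩ := exists_decomposition X
  rw [dim, ← h, ← trₗ_apply, map_sum]
  refine Finset.sum_congr rfl fun Z _ => ?_
  rw [map_sum, Finset.sum_congr rfl fun i _ => by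
    rw [trₗ_apply, tr_comp_comm, hqp, if_pos rfl]]
  simp [dim]

/-- The map `coevR X` is nonzero by a zigzag identity, so it has a retraction `ᘁX ⊗ X ⟶ 𝟙_`. Bending
identifies such maps with endomorphisms of `X`, so the retraction is a multiple of `evL X`. -/
theorem coevR_comp_evL_ne_zero {X : D} (h : IsSimple X) : coevR X ≫ evL X ≠ 0 := by
  intro h0
  have hne : coevR X ≠ 0 := by
    intro hc
    apply h.id_ne_zero
    have := (ExactPairing.coevaluation_evaluation (ᘁX : D) X)
    change X ◁ coevR X ≫ _ = _ at this
    rw [hc, MonoidalPreadditive.whiskerLeft_zero, Limits.zero_comp] at this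
    rw [← cancel_epi (ρ_ X).hom, ← cancel_mono (λ_ X).inv, Category.assoc, Category.id_comp,
      ← this]
    simp
  obtain ⟨p, hp⟩ := (FusionCategory.unit_isSimple (C := D)).exists_retraction (coevR X) hne
  let := leftPairing X
  obtain ⟨c, hc⟩ := h.exists_smul_id (tensorLeftHomEquiv X X (ᘁX : D) (𝟙_ D)
    ((ᘁX : D) ◁ 𝟙 X ≫ p) ≫ (ρ_ X).hom)
  have hp' : p = c • evL X := by
    rw [← Iso.eq_comp_inv, ← Equiv.eq_symm_apply] at hc
    rw [whiskerLeft_id, Category.id_comp] at hc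
    rw [hc]
    change (ᘁX : D) ◁ _ ≫ _ ≫ evL X ▷ _ ≫ _ = _
    simp only [MonoidalLinear.whiskerLeft_smul, Linear.smul_comp, Category.id_comp]
    congr 1
    monoidal
  rw [hp', Linear.comp_smul, h0, smul_zero] at hp
  exact FusionCategory.unit_isSimple.id_ne_zero hp.symm

variable [BraidedCategory D] [RibbonCategory D]

theorem coevR_comp_evL (X : D) : coevR X ≫ evL X = dim X • 𝟙 (𝟙_ D) := by
  rw [← trR_id, ← trL_id, trL, whiskerLeft_id, Category.id_comp]

theorem dim_ne_zero {X : D} (h : IsSimple X) : dim X ≠ 0 := fun h0 =>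
  coevR_comp_evL_ne_zero h (by rw [coevR_comp_evL, h0, zero_smul])

theorem dim_dual (X : D) : dim (ᘁX : D) = dim X := by
  rw [dim, tr, trR_id_dual]; rfl

/-- This dimension is idempotent by multiplicativity, and nonzero. -/
theorem dim_unit : dim (𝟙_ D) = 1 := by
  have h := dim_tensor (𝟙_ D) (𝟙_ D)
  rw [dim_congr (λ_ (𝟙_ D))] at h
  exact (mul_eq_left₀ (dim_ne_zero FusionCategory.unit_isSimple)).1 h.symm

/-- The linear equivalence given by an equivalence of hom-sets that bends a strand. -/
def tensorLeftHomLinearEquiv (X Y Y' Z : D) [ExactPairing Y Y'] :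
    (Y' ⊗ X ⟶ Z) ≃ₗ[ℂ] (X ⟶ Y ⊗ Z) where
  __ := tensorLeftHomEquiv X Y Y' Z
  map_add' f g := by simp [tensorLeftHomEquiv]
  map_smul' c f := by simp [tensorLeftHomEquiv]

theorem sum_normSq_dim_pos : 0 < ∑ Z : Irr D, Complex.normSq (dim (simple Z)) := by
  obtain ⟨Z, ⟨e⟩⟩ := exists_unit_iso (D := D)
  refine Finset.sum_pos' (fun _ _ => Complex.normSq_nonneg _) ⟨Z, Finset.mem_univ _, ?_⟩
  rw [← dim_congr e, dim_unit, Complex.normSq_one]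
  exact one_pos

open ComplexConjugate in
-- The vector of dimensions is an eigenvector of the fusion matrix of `X` with eigenvalue `dim X`,
-- and of its transpose, the fusion matrix of `ᘁX`, with the same eigenvalue. Pairing the vector
-- with its conjugate in both ways gives the claim, as its norm is positive.
theorem conj_dim (X : D) : conj (dim X) = dim X := by
  have hN : ∀ Z W : Irr D, Module.finrank ℂ (X ⊗ simple Z ⟶ simple W) =
      Module.finrank ℂ ((ᘁX) ⊗ simple W ⟶ simple Z) := by
    intro Z W
    rw [← (isSimple_simple Z).finrank_hom_comm,
      (tensorLeftHomLinearEquiv (simple Z) (ᘁX : D) X (simple W)).finrank_eq]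
  have h1 : dim X * ∑ Z : Irr D, dim (simple Z) * conj (dim (simple Z)) =
      ∑ Z : Irr D, ∑ W : Irr D, (Module.finrank ℂ (X ⊗ simple Z ⟶ simple W) : ℂ) *
        dim (simple W) * conj (dim (simple Z)) := by
    rw [Finset.mul_sum]
    refine Finset.sum_congr rfl fun Z _ => ?_
    rw [← mul_assoc, ← dim_tensor, dim_eq_sum, Finset.sum_mul]
  have h2 : conj (dim X) * ∑ W : Irr D, dim (simple W) * conj (dim (simple W)) =
      ∑ W : Irr D, ∑ Z : Irr D, (Module.finrank ℂ (X ⊗ simple Z ⟶ simple W) : ℂ) *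
        dim (simple W) * conj (dim (simple Z)) := by
    rw [Finset.mul_sum]
    refine Finset.sum_congr rfl fun W _ => ?_
    rw [mul_left_comm, ← map_mul, ← dim_dual X, ← dim_tensor,
      dim_eq_sum ((ᘁX) ⊗ simple W), map_sum,
      Finset.mul_sum]
    refine Finset.sum_congr rfl fun Z _ => ?_
    rw [map_mul, Complex.conj_natCast, hN]
    ring
  have h3 : ∑ Z : Irr D, dim (simple Z) * conj (dim (simple Z)) ≠ 0 := by
    simp only [Complex.mul_conj, ← Complex.ofReal_sum]
    exact_mod_cast sum_normSq_dim_pos.ne'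
  rw [Finset.sum_comm] at h2
  exact mul_right_cancel₀ h3 (h2.trans h1.symm)

theorem globalDim_ne_zero : globalDim D ≠ 0 := by
  have h : globalDim D = ((∑ Z : Irr D, Complex.normSq (dim (simple Z)) : ℝ) : ℂ) := by
    rw [Complex.ofReal_sum]
    refine Finset.sum_congr rfl fun Z _ => ?_
    rw [← Complex.mul_conj, conj_dim, sq]
  rw [h]
  exact_mod_cast sum_normSq_dim_pos.ne'

end Trace

/-! ### Circles around an object -/

section Encirclement

variable {D : Type u₂} [Category.{v₂} D] [MonoidalCategory D] [BraidedCategory D]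

/-- The double braiding. -/
def monodromy (X Y : D) : X ⊗ Y ⟶ X ⊗ Y := (β_ X Y).hom ≫ (β_ Y X).hom

theorem monodromy_naturality_left {X X' : D} (f : X ⟶ X') (Y : D) :
    f ▷ Y ≫ monodromy X' Y = monodromy X Y ≫ f ▷ Y := by
  simp [monodromy]

theorem monodromy_naturality_right (X : D) {Y Y' : D} (f : Y ⟶ Y') :
    X ◁ f ≫ monodromy X Y' = monodromy X Y ≫ X ◁ f := by
  simp [monodromy]

/-- A morphism `Y ⊗ W ⟶ Y ⊗ W` in which a strand `V` that comes from `W` goes once around `Y`. -/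
def aroundStrand (Y : D) {W V T : D} (a : W ⟶ V ⊗ T) (b : V ⊗ T ⟶ W) : Y ⊗ W ⟶ Y ⊗ W :=
  Y ◁ a ≫ (α_ _ _ _).inv ≫ monodromy Y V ▷ T ≫ (α_ _ _ _).hom ≫ Y ◁ b

theorem aroundStrand_whiskerLeft (Y : D) {W V T T' : D} (a : W ⟶ V ⊗ T) (x : T ⟶ T')
    (b : V ⊗ T' ⟶ W) :
    aroundStrand Y (a ≫ V ◁ x) b = aroundStrand Y a (V ◁ x ≫ b) := by
  simp only [aroundStrand, whiskerLeft_comp, Category.assoc]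
  rw [← associator_naturality_right_assoc, ← whisker_exchange_assoc]
  simp

theorem aroundStrand_whiskerRight (Y : D) {W V V' T : D} (a : W ⟶ V ⊗ T) (f : V ⟶ V')
    (b : V' ⊗ T ⟶ W) :
    aroundStrand Y (a ≫ f ▷ T) b = aroundStrand Y a (f ▷ T ≫ b) := by
  simp only [aroundStrand, whiskerLeft_comp, Category.assoc]
  rw [← associator_naturality_middle_assoc, ← comp_whiskerRight_assoc,
    ← monodromy_naturality_right, comp_whiskerRight_assoc, associator_inv_naturality_middle_assoc]

variable [LeftRigidCategory D] [PivotalCategory D]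

/-- The endomorphism of `Y` given by a circle with label `Z` around `Y`. -/
def encirclement (Z Y : D) : Y ⟶ Y :=
  (ρ_ Y).inv ≫ Y ◁ coevL Z ≫ (α_ _ _ _).inv ≫ monodromy Y Z ▷ (ᘁZ : D) ≫
    (α_ _ _ _).hom ≫ Y ◁ evR Z ≫ (ρ_ Y).hom

theorem encirclement_naturality (Z : D) {Y Y' : D} (f : Y ⟶ Y') :
    f ≫ encirclement Z Y' = encirclement Z Y ≫ f := by
  have h : f ▷ (Z ⊗ (ᘁZ)) ≫ (α_ Y' Z (ᘁZ)).inv ≫ monodromy Y' Z ▷ (ᘁZ : D) =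
      (α_ Y Z (ᘁZ)).inv ≫ monodromy Y Z ▷ (ᘁZ : D) ≫ f ▷ Z ▷ (ᘁZ : D) := by
    rw [← comp_whiskerRight, ← monodromy_naturality_left]; simp
  rw [encirclement, rightUnitor_inv_naturality_assoc, ← whisker_exchange_assoc,
    reassoc_of% h, encirclement]
  simp only [Category.assoc]
  rw [associator_naturality_left_assoc, ← whisker_exchange_assoc]
  simp

theorem encirclement_unit (Z : D) : encirclement Z (𝟙_ D) = trR (𝟙 Z) := by
  rw [encirclement, trR]
  simp [monodromy, unitors_inv_equal]
  rw [unitors_equal, Iso.inv_hom_id_assoc]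

/-- The circle around `Y`, drawn between `Y` and `W`. -/
theorem aroundStrand_coevL_evR_left (Y V W : D) :
    aroundStrand Y ((λ_ W).inv ≫ coevL V ▷ W ≫ (α_ _ _ _).hom)
      ((α_ _ _ _).inv ≫ evR V ▷ W ≫ (λ_ W).hom) = encirclement V Y ▷ W := by
  rw [aroundStrand, encirclement]
  monoidal

/-- If `W` runs around `Y` parallel to the circle `Z`, the hexagon puts the circle inside the two
crossings of `Y` with `W`; naturality then pulls the crossings together into a monodromy. -/
theorem aroundStrand_coevL_evR_right (Y Z W : D) :
    aroundStrand Y ((ρ_ W).inv ≫ W ◁ coevL Z ≫ (α_ W Z (ᘁZ : D)).inv)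
      ((α_ W Z (ᘁZ : D)).hom ≫ W ◁ evR Z ≫ (ρ_ W).hom) =
      encirclement Z Y ▷ W ≫ monodromy Y W := by
  have h : monodromy Y (W ⊗ Z) = (α_ _ _ _).inv ≫ (β_ Y W).hom ▷ Z ≫ (α_ _ _ _).hom ≫
      W ◁ monodromy Y Z ≫ (α_ _ _ _).inv ≫ (β_ W Y).hom ▷ Z ≫ (α_ _ _ _).hom := by
    simp [monodromy, BraidedCategory.braiding_tensor_left_hom,
      BraidedCategory.braiding_tensor_right_hom]
  calc
    _ = 𝟙 _ ⊗≫ ((Y ⊗ W) ◁ coevL Z ≫ (β_ Y W).hom ▷ (Z ⊗ (ᘁZ))) ⊗≫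
        W ◁ (monodromy Y Z ▷ (ᘁZ : D)) ⊗≫
        ((β_ W Y).hom ▷ (Z ⊗ (ᘁZ)) ≫ (Y ⊗ W) ◁ evR Z) ⊗≫ 𝟙 _ := by
      rw [aroundStrand, h]
      monoidal
    _ = (β_ Y W).hom ≫ W ◁ encirclement Z Y ≫ (β_ W Y).hom := by
      rw [whisker_exchange (β_ Y W).hom (coevL Z), ← whisker_exchange (β_ W Y).hom (evR Z),
        encirclement]
      monoidal
    _ = _ := by
      rw [monodromy, BraidedCategory.braiding_naturality_left_assoc]

end Encirclement

/-! ### Bending trivalent vertices -/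

section Bending

variable {D : Type u₂} [Category.{v₂} D] [MonoidalCategory D] [LeftRigidCategory D]
  [PivotalCategory D]

/-- Bending the strand `Z` of `p : W ⊗ Z ⟶ V` to the top and the strand `V` to the bottom. -/
def bendIn {V W Z : D} (p : W ⊗ Z ⟶ V) : (ᘁV) ⊗ W ⟶ (ᘁZ : D) :=
  (@tensorLeftHomEquiv _ _ _ W V (ᘁV : D) (ᘁZ : D) (leftPairing V)).symm
    (@tensorRightHomEquiv _ _ _ W Z (ᘁZ : D) V (leftPairing Z) p)

/-- Bending the strand `Z` of `q : V ⟶ W ⊗ Z` to the bottom and the strand `V` to the top. -/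
def bendOut {V W Z : D} (q : V ⟶ W ⊗ Z) : (ᘁZ : D) ⟶ (ᘁV) ⊗ W :=
  tensorLeftHomEquiv (ᘁZ : D) (ᘁV : D) V W ((tensorRightHomEquiv V (ᘁZ : D) Z W).symm q)

/-- Both sides are the same closed theta-shaped diagram, cut open at `Z` or at `V`. This is what
compares normalisations before and after bending. -/
theorem trace_bendOut_comp_bendIn {V W Z : D} (p : W ⊗ Z ⟶ V) (q : V ⟶ W ⊗ Z) :
    coevR Z ≫ (bendOut q ≫ bendIn p) ▷ Z ≫ evL Z = coevR V ≫ (ᘁV : D) ◁ (q ≫ p) ≫ evL V := by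
  have h₁ : Z ◁ coevR Z ⊗≫ evR Z ▷ Z = ⊗𝟙.hom :=
    ExactPairing.coevaluation_evaluation'' (ᘁZ : D) Z
  have h₂ : coevL Z ▷ Z ⊗≫ Z ◁ evL Z = ⊗𝟙.hom :=
    @ExactPairing.evaluation_coevaluation'' _ _ _ Z (ᘁZ : D) (leftPairing Z)
  have hin : bendIn p = (ᘁV : D) ◁ ((ρ_ _).inv ≫ W ◁ coevL Z ≫ (α_ _ _ _).inv ≫ p ▷ (ᘁZ : D)) ≫
    (α_ _ _ _).inv ≫ evL V ▷ (ᘁZ : D) ≫ (λ_ _).hom := rfl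
  have hout : bendOut q = (λ_ _).inv ≫ coevR V ▷ (ᘁZ : D) ≫ (α_ _ _ _).hom ≫
    (ᘁV : D) ◁ (q ▷ (ᘁZ : D) ≫ (α_ _ _ _).hom ≫ W ◁ evR Z ≫ (ρ_ _).hom) := rfl
  calc
    _ = 𝟙 _ ⊗≫ (𝟙_ D ◁ coevR Z ≫ coevR V ▷ ((ᘁZ) ⊗ Z)) ⊗≫ (ᘁV : D) ◁ q ▷ ((ᘁZ) ⊗ Z) ⊗≫
        (ᘁV : D) ◁ W ◁ evR Z ▷ Z ⊗≫ (ᘁV : D) ◁ W ◁ coevL Z ▷ Z ⊗≫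
        (ᘁV : D) ◁ p ▷ ((ᘁZ) ⊗ Z) ⊗≫ (evL V ▷ ((ᘁZ) ⊗ Z) ≫ 𝟙_ D ◁ evL Z) ⊗≫ 𝟙 _ := by
      rw [hin, hout]; monoidal
    _ = 𝟙 _ ⊗≫ coevR V ⊗≫ (ᘁV : D) ◁ (V ◁ coevR Z ≫ q ▷ ((ᘁZ) ⊗ Z)) ⊗≫
        (ᘁV : D) ◁ W ◁ evR Z ▷ Z ⊗≫ (ᘁV : D) ◁ W ◁ coevL Z ▷ Z ⊗≫
        (ᘁV : D) ◁ (p ▷ ((ᘁZ) ⊗ Z) ≫ V ◁ evL Z) ⊗≫ evL V ⊗≫ 𝟙 _ := by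
      rw [whisker_exchange (coevR V) (coevR Z), ← whisker_exchange (evL V) (evL Z)]; monoidal
    _ = 𝟙 _ ⊗≫ coevR V ⊗≫ (ᘁV : D) ◁ q ⊗≫
        (ᘁV : D) ◁ W ◁ (Z ◁ coevR Z ⊗≫ evR Z ▷ Z) ⊗≫
        (ᘁV : D) ◁ W ◁ (coevL Z ▷ Z ⊗≫ Z ◁ evL Z) ⊗≫
        (ᘁV : D) ◁ p ⊗≫ evL V ⊗≫ 𝟙 _ := by
      rw [whisker_exchange q (coevR Z), ← whisker_exchange p (evL Z)]; monoidal
    _ = _ := by rw [h₁, h₂]; monoidal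

variable [BraidedCategory D]

/-- A summand `V` of `W ⊗ Z` that runs around `Y` becomes a circle `V` around `Y`, while `W` passes
beside it, joined to the circle by the bent vertices. -/
theorem aroundStrand_bend (Y : D) {V W Z : D} (p : W ⊗ Z ⟶ V) (q : V ⟶ W ⊗ Z) :
    aroundStrand Y
      (((ρ_ W).inv ≫ W ◁ coevL Z ≫ (α_ W Z (ᘁZ : D)).inv) ≫ p ▷ (ᘁZ : D))
      (q ▷ (ᘁZ : D) ≫ (α_ W Z (ᘁZ : D)).hom ≫ W ◁ evR Z ≫ (ρ_ W).hom) =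
    aroundStrand Y
      ((λ_ W).inv ≫ coevL V ▷ W ≫ (α_ _ _ _).hom)
      (V ◁ (bendIn p ≫ bendOut q) ≫ (α_ _ _ _).inv ≫ evR V ▷ W ≫ (λ_ W).hom) := by
  have h1 : ((ρ_ W).inv ≫ W ◁ coevL Z ≫ (α_ W Z (ᘁZ : D)).inv) ≫ p ▷ (ᘁZ : D) =
      ((λ_ W).inv ≫ coevL V ▷ W ≫ (α_ _ _ _).hom) ≫ V ◁ bendIn p := by
    have := (@tensorLeftHomEquiv _ _ _ W V (ᘁV : D) (ᘁZ : D) (leftPairing V)).apply_symm_apply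
      (@tensorRightHomEquiv _ _ _ W Z (ᘁZ : D) V (leftPairing Z) p)
    simp only [Category.assoc]
    exact this.symm
  have h2 : q ▷ (ᘁZ : D) ≫ (α_ W Z (ᘁZ : D)).hom ≫ W ◁ evR Z ≫ (ρ_ W).hom =
      V ◁ bendOut q ≫ (α_ _ _ _).inv ≫ evR V ▷ W ≫ (λ_ W).hom := by
    exact ((tensorLeftHomEquiv (ᘁZ : D) (ᘁV : D) V W).symm_apply_apply
      ((tensorRightHomEquiv V (ᘁZ : D) Z W).symm q)).symm
  rw [h1, h2, aroundStrand_whiskerLeft, whiskerLeft_comp, Category.assoc]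

end Bending

/-! ### The handle slide and the killing property -/

section Killing

variable {D : Type u₂} [Category.{v₂} D] [Preadditive D] [Linear ℂ D]
  [MonoidalCategory D] [MonoidalPreadditive D] [MonoidalLinear ℂ D]
  [LeftRigidCategory D] [FusionCategory D]

/-- Bending a strand on the right, as a linear equivalence. -/
def tensorRightHomLinearEquiv (X Y Y' Z : D) [ExactPairing Y Y'] :
    (X ⊗ Y ⟶ Z) ≃ₗ[ℂ] (X ⟶ Z ⊗ Y') where
  __ := tensorRightHomEquiv X Y Y' Z
  map_add' f g := by simp [tensorRightHomEquiv]
  map_smul' c f := by simp [tensorRightHomEquiv]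

/-- Morphisms between duals. -/
def mateLinearEquiv (X Y : D) : (X ⟶ Y) ≃ₗ[ℂ] ((ᘁY : D) ⟶ (ᘁX : D)) :=
  (Linear.homCongr ℂ (ρ_ X).symm (Iso.refl Y)).trans <|
  (tensorLeftHomLinearEquiv (𝟙_ D) (ᘁX : D) X Y).trans <|
  (tensorRightHomLinearEquiv (𝟙_ D) (ᘁY : D) Y (ᘁX : D)).symm.trans <|
  Linear.homCongr ℂ (λ_ (ᘁY : D)) (Iso.refl (ᘁX : D))

theorem IsSimple.dual {X : D} (h : IsSimple X) : IsSimple (ᘁX : D) := by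
  rw [IsSimple, ← (mateLinearEquiv X X).finrank_eq]
  exact h

theorem hom_dual_simple_eq_zero (Z Z' : Irr D) (h : Z ≠ Z')
    (f : (ᘁ(simple Z) : D) ⟶ (ᘁ(simple Z'))) : f = 0 := by
  rw [← (mateLinearEquiv _ _).apply_symm_apply f,
    hom_simple_eq_zero h.symm ((mateLinearEquiv _ _).symm f), map_zero]

variable [PivotalCategory D]

theorem exists_iso_dual_simple (Z : Irr D) :
    ∃ Z' : Irr D, Nonempty (simple Z ≅ (ᘁ(simple Z') : D)) := by
  obtain ⟨Z', ⟨e⟩⟩ := (isSimple_simple Z).dual.exists_iso_simple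
  refine ⟨Z', ⟨pivot (simple Z) ≪≫ ⟨ᘁe.inv, ᘁe.hom, ?_, ?_⟩⟩⟩
  · rw [← comp_leftAdjointMate, e.hom_inv_id, leftAdjointMate_id]
  · rw [← comp_leftAdjointMate, e.inv_hom_id, leftAdjointMate_id]

/-- `bendIn` as a linear equivalence. -/
def bendInLinearEquiv (V W Z : D) : (W ⊗ Z ⟶ V) ≃ₗ[ℂ] ((ᘁV) ⊗ W ⟶ (ᘁZ : D)) :=
  letI := leftPairing V
  letI := leftPairing Z
  (tensorRightHomLinearEquiv W Z (ᘁZ : D) V).trans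
    (tensorLeftHomLinearEquiv W V (ᘁV : D) (ᘁZ : D)).symm

theorem bendInLinearEquiv_apply {V W Z : D} (p : W ⊗ Z ⟶ V) :
    bendInLinearEquiv V W Z p = bendIn p := rfl

variable [BraidedCategory D] [RibbonCategory D]

/-- Bent bases of `W ⊗ Z ⟶ V` are bases of `ᘁV ⊗ W ⟶ ᘁZ`. The bent dual vectors are dual to them up
to the factor `dim V / dim Z`, so the sum is a rescaled resolution of the identity of `ᘁV ⊗ W`. -/
theorem sum_dim_smul_bendIn_comp_bendOut (V : Irr D) (W : D) {n : Irr D → Type*}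
    [∀ Z, Fintype (n Z)] [∀ Z, DecidableEq (n Z)]
    (p : ∀ Z : Irr D, Module.Basis (n Z) ℂ (W ⊗ simple Z ⟶ simple V))
    (q : ∀ Z : Irr D, n Z → (simple V ⟶ W ⊗ simple Z))
    (hqp : ∀ Z i j, q Z i ≫ p Z j = if i = j then 𝟙 (simple V) else 0) :
    ∑ Z : Irr D, ∑ i, dim (simple Z) • (bendIn (p Z i) ≫ bendOut (q Z i)) =
      dim (simple V) • 𝟙 ((ᘁ(simple V)) ⊗ W) := by
  have hdV := dim_ne_zero (isSimple_simple V)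
  -- The composite is a scalar by simplicity of the dual; taking traces on both sides determines it.
  have key : ∀ Z i j, bendOut (q Z i) ≫ bendIn (p Z j) =
      if i = j then (dim (simple V) / dim (simple Z)) • 𝟙 (ᘁ(simple Z) : D) else 0 := by
    intro Z i j
    have hdZ := dim_ne_zero (isSimple_simple Z)
    obtain ⟨c, hc⟩ := (isSimple_simple Z).dual.exists_smul_id (bendOut (q Z i) ≫ bendIn (p Z j))
    have h := trace_bendOut_comp_bendIn (p Z j) (q Z i)
    rw [hc, hqp, MonoidalLinear.smul_whiskerRight, id_whiskerRight, Linear.smul_comp,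
      Category.id_comp, Linear.comp_smul, coevR_comp_evL, smul_smul] at h
    rw [hc]
    split_ifs with hij
    · rw [if_pos hij, whiskerLeft_id, Category.id_comp, coevR_comp_evL] at h
      have := FusionCategory.unit_isSimple.smul_id_injective h
      rw [← this, mul_div_cancel_right₀ _ hdZ]
    · rw [if_neg hij, MonoidalPreadditive.whiskerLeft_zero, Limits.zero_comp,
        Limits.comp_zero, ← zero_smul ℂ (𝟙 (𝟙_ D))] at h
      have := FusionCategory.unit_isSimple.smul_id_injective h
      rw [(mul_eq_zero.1 this).resolve_right hdZ, zero_smul]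
  have h := sum_comp_eq_id (X := (ᘁ(simple V)) ⊗ W) (S := fun Z : Irr D => (ᘁ(simple Z) : D))
    exists_iso_dual_simple hom_dual_simple_eq_zero
    (fun Z i => bendIn (p Z i))
    (fun Z i => (dim (simple Z) / dim (simple V)) • bendOut (q Z i))
    (fun Z => by
      have := ((p Z).map (bendInLinearEquiv (simple V) W (simple Z))).span_eq
      simpa [Module.Basis.coe_map, Function.comp_def, bendInLinearEquiv_apply] using this)
    (fun Z i j => by
      have hdZ := dim_ne_zero (isSimple_simple Z)
      rw [Linear.smul_comp, key]
      split_ifs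
      · rw [smul_smul, div_mul_div_cancel₀ hdV, div_self hdZ, one_smul]
      · rw [smul_zero])
  rw [← h, Finset.smul_sum]
  refine Finset.sum_congr rfl fun Z _ => ?_
  rw [Finset.smul_sum]
  refine Finset.sum_congr rfl fun i _ => ?_
  rw [Linear.comp_smul, smul_smul, mul_div_cancel₀ _ hdV]

/-- `aroundStrand` as a linear map. -/
def aroundStrandLinearMap (Y : D) {W V T : D} (a : W ⟶ V ⊗ T) :
    (V ⊗ T ⟶ W) →ₗ[ℂ] (Y ⊗ W ⟶ Y ⊗ W) where
  toFun b := aroundStrand Y a b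
  map_add' b b' := by simp [aroundStrand]
  map_smul' c b := by simp [aroundStrand]

theorem aroundStrandLinearMap_apply (Y : D) {W V T : D} (a : W ⟶ V ⊗ T) (b : V ⊗ T ⟶ W) :
    aroundStrandLinearMap Y a b = aroundStrand Y a b := rfl

/-- The circle with label `V` around `Y`, next to `W`, with an endomorphism inserted into the
parallel strands `ᘁV` and `W`. -/
def insertOnCircle (Y V W : D) : ((ᘁV) ⊗ W ⟶ (ᘁV) ⊗ W) →ₗ[ℂ] (Y ⊗ W ⟶ Y ⊗ W) where
  toFun g := aroundStrand Y ((λ_ W).inv ≫ coevL V ▷ W ≫ (α_ _ _ _).hom)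
    (V ◁ g ≫ (α_ _ _ _).inv ≫ evR V ▷ W ≫ (λ_ W).hom)
  map_add' b b' := by simp [aroundStrand]
  map_smul' c b := by simp [aroundStrand]

theorem insertOnCircle_apply (Y V W : D) (g : (ᘁV) ⊗ W ⟶ (ᘁV) ⊗ W) :
    insertOnCircle Y V W g =
      aroundStrand Y ((λ_ W).inv ≫ coevL V ▷ W ≫ (α_ _ _ _).hom)
        (V ◁ g ≫ (α_ _ _ _).inv ≫ evR V ▷ W ≫ (λ_ W).hom) := rfl

theorem insertOnCircle_id (Y V W : D) :
    insertOnCircle Y V W (𝟙 _) = encirclement V Y ▷ W := by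
  rw [insertOnCircle_apply, whiskerLeft_id, Category.id_comp, aroundStrand_coevL_evR_left]

/-- The endomorphism of `Y` given by a circle around `Y` with the Kirby colour. -/
def killing (Y : D) : Y ⟶ Y := ∑ Z : Irr D, dim (simple Z) • encirclement (simple Z) Y

theorem killing_naturality {Y Y' : D} (f : Y ⟶ Y') : f ≫ killing Y' = killing Y ≫ f := by
  simp only [killing, Preadditive.comp_sum, Preadditive.sum_comp, Linear.comp_smul,
    Linear.smul_comp, encirclement_naturality]

theorem killing_unit : killing (𝟙_ D) = globalDim D • 𝟙 (𝟙_ D) := by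
  simp only [killing, encirclement_unit, trR_id, smul_smul, globalDim, ← Finset.sum_smul, sq]

/-- Sliding a strand over the circle with the Kirby colour. -/
theorem killing_whiskerRight_comp_monodromy (Y W : D) :
    killing Y ▷ W ≫ monodromy Y W = killing Y ▷ W := by
  -- The monodromy with `W` joins `W` to the circle `Z`. Decomposing `W ⊗ Z` into simple `V` and
  -- exchanging the sums over `Z` and `V` turns the circle `Z` into a circle `V`; for fixed `V` the
  -- sum over `Z` is then an identity on `ᘁV ⊗ W`.
  choose p q hqp hid using fun Z : Irr D => exists_decomposition (W ⊗ simple Z)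
  have h1 : ∀ Z : Irr D, encirclement (simple Z) Y ▷ W ≫ monodromy Y W =
      ∑ V : Irr D, ∑ i, insertOnCircle Y (simple V) W (bendIn (p Z V i) ≫ bendOut (q Z V i)) := by
    intro Z
    have h2 : (α_ W (simple Z) (ᘁ(simple Z) : D)).hom ≫ W ◁ evR (simple Z) ≫ (ρ_ W).hom =
      ∑ V : Irr D, ∑ i, p Z V i ▷ (ᘁ(simple Z) : D) ≫ q Z V i ▷ (ᘁ(simple Z) : D) ≫
        (α_ W (simple Z) (ᘁ(simple Z) : D)).hom ≫ W ◁ evR (simple Z) ≫ (ρ_ W).hom := by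
      simp only [← comp_whiskerRight_assoc, ← Preadditive.sum_comp,
        ← sum_whiskerRight, hid, id_whiskerRight, Category.id_comp]
    rw [← aroundStrand_coevL_evR_right, ← aroundStrandLinearMap_apply, h2, map_sum]
    refine Finset.sum_congr rfl fun V _ => ?_
    rw [map_sum]
    refine Finset.sum_congr rfl fun i _ => ?_
    rw [aroundStrandLinearMap_apply, ← aroundStrand_whiskerRight, aroundStrand_bend,
      insertOnCircle_apply]
  have h3 : killing Y ▷ W ≫ monodromy Y W =
      ∑ Z : Irr D, dim (simple Z) • (encirclement (simple Z) Y ▷ W ≫ monodromy Y W) := by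
    simp only [killing, sum_whiskerRight, MonoidalLinear.smul_whiskerRight,
      Preadditive.sum_comp, Linear.smul_comp]
  calc
    _ = ∑ V : Irr D, ∑ Z : Irr D, ∑ i, insertOnCircle Y (simple V) W
        (dim (simple Z) • (bendIn (p Z V i) ≫ bendOut (q Z V i))) := by
      rw [h3, Finset.sum_comm]
      refine Finset.sum_congr rfl fun Z _ => ?_
      rw [h1, Finset.smul_sum]
      refine Finset.sum_congr rfl fun V _ => ?_
      rw [Finset.smul_sum]
      refine Finset.sum_congr rfl fun i _ => ?_
      rw [map_smul]
    _ = ∑ V : Irr D, dim (simple V) • (encirclement (simple V) Y ▷ W) := by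
      refine Finset.sum_congr rfl fun V _ => ?_
      have := sum_dim_smul_bendIn_comp_bendOut V W (fun Z => p Z V) (fun Z => q Z V)
        (fun Z => hqp Z V)
      simp only [← map_sum]
      rw [this, map_smul, insertOnCircle_id]
    _ = _ := by
      simp only [killing, sum_whiskerRight, MonoidalLinear.smul_whiskerRight]

variable [IsModular D]

/-- If the circle acts by a nonzero scalar, the handle slide with that scalar cancelled says that
`Z` is transparent. -/
theorem killing_simple (Z : Irr D) :
    killing (simple Z) = 0 ∨ Nonempty (simple Z ≅ 𝟙_ D) := by
  obtain ⟨c, hc⟩ := (isSimple_simple Z).exists_smul_id (killing (simple Z))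
  by_cases h0 : c = 0
  · exact Or.inl (by rw [hc, h0, zero_smul])
  · refine Or.inr (IsModular.iso_unit Z fun W => ?_)
    have h := killing_whiskerRight_comp_monodromy (simple Z) W
    rw [hc, MonoidalLinear.smul_whiskerRight, id_whiskerRight, Linear.smul_comp,
      Category.id_comp] at h
    exact smul_right_injective _ h0 h

/-- By cyclicity the pairing is the trace of an endomorphism of the unit, which is its scalar
because the unit has dimension one. -/
theorem DualBases.dual_comp_basis {Y : D} (B : DualBases Y) (i j : Fin B.card) :
    B.dual i ≫ B.basis j = if i = j then 𝟙 (𝟙_ D) else 0 := by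
  have h := B.pairing j i
  rw [sphericalPairing, tr_comp_comm, scalar_spec (B.dual i ≫ B.basis j), ← trₗ_apply,
    map_smul, trₗ_apply, smul_eq_mul] at h
  change _ * dim (𝟙_ D) = _ at h
  rw [dim_unit, mul_one] at h
  rw [scalar_spec (B.dual i ≫ B.basis j), h]
  by_cases hij : i = j
  · rw [if_pos hij, if_pos hij.symm, one_smul]
  · rw [if_neg hij, if_neg (Ne.symm hij), zero_smul]

/-- A circle with the Kirby colour cuts the strands that it encircles. -/
theorem killing_eq_sum {Y : D} (B : DualBases Y) :
    killing Y = globalDim D • ∑ i, B.basis i ≫ B.dual i := by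
  -- The sum is the projection onto the unit-isotypic part of `Y`.
  have hE : ∀ q : 𝟙_ D ⟶ Y, q ≫ ∑ i, B.basis i ≫ B.dual i = q := by
    intro q
    have hq : q ∈ Submodule.span ℂ (Set.range B.dual) := by rw [B.dual.span_eq]; trivial
    induction hq using Submodule.span_induction with
    | mem q hq =>
      obtain ⟨j, rfl⟩ := hq
      rw [Preadditive.comp_sum, Finset.sum_eq_single j]
      · rw [← Category.assoc, B.dual_comp_basis, if_pos rfl, Category.id_comp]
      · intro i _ hi
        rw [← Category.assoc, B.dual_comp_basis, if_neg hi.symm, Limits.zero_comp]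
      · simp
    | zero => rw [Limits.zero_comp]
    | add a b _ _ ha hb => rw [Preadditive.add_comp, ha, hb]
    | smul c a _ ha => rw [Linear.smul_comp, ha]
  -- Composites through simple objects other than the unit are annihilated by the circle, and the
  -- projection fixes those through the unit.
  have h1 : killing Y ≫ ∑ i, B.basis i ≫ B.dual i = killing Y := by
    have : ∀ f : Y ⟶ Y, (f ≫ killing Y) ≫ ∑ i, B.basis i ≫ B.dual i = f ≫ killing Y := by
      intro f
      refine simple_induction
        (P := fun f => (f ≫ killing Y) ≫ ∑ i, B.basis i ≫ B.dual i = f ≫ killing Y) f (fun Z p q => ?_) ?_ ?_ ?_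
      · rw [Category.assoc p, killing_naturality]
        rcases killing_simple Z with h | ⟨⟨e⟩⟩
        · simp [h]
        · have := hE (e.inv ≫ q)
          rw [Category.assoc, cancel_epi] at this
          simp only [Category.assoc, this]
      · simp
      · intro a b ha hb
        rw [Preadditive.add_comp, Preadditive.add_comp, ha, hb]
      · intro c a ha
        rw [Linear.smul_comp, Linear.smul_comp, ha]
    simpa using this (𝟙 Y)
  rw [← h1, Preadditive.comp_sum, Finset.smul_sum]
  refine Finset.sum_congr rfl fun i _ => ?_
  rw [← Category.assoc, ← killing_naturality, killing_unit, Linear.comp_smul, Category.comp_id,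
    Linear.smul_comp]

end Killing

/-! ### Isotopies preserve the number of boxes -/

section BoxCount

variable {ι : Type} {S : BoxSig ι}

namespace Diagram

theorem boxCount_fullTwist (b : S.Box) (V : Word ι) : (fullTwist (S := S) V).boxCount b = 0 := by
  induction V with
  | unit => rfl
  | strand j c => rfl
  | tensor V W hV hW => simp [fullTwist, boxCount, hV, hW]

theorem Isotopic.boxCount_eq {V W : Word ι} {f g : Diagram S V W} (h : Isotopic f g)
    (b : S.Box) : f.boxCount b = g.boxCount b := by
  induction h with
  | refl => rfl
  | symm _ ih => exact ih.symm
  | trans _ _ ih₁ ih₂ => exact ih₁.trans ih₂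
  | comp _ _ ih₁ ih₂ => simp only [boxCount, ih₁, ih₂]
  | tensor _ _ ih₁ ih₂ => simp only [boxCount, ih₁, ih₂]
  | fullTwist_naturality f => simp only [boxCount, boxCount_fullTwist, add_zero, zero_add]
  | _ => simp only [boxCount, curl, curlInv] <;> omega

theorem boxCount_box_self (b : S.Box) : (piece (.box b) : Diagram S _ _).boxCount b = 1 := by
  simp [boxCount]

theorem boxCount_box_of_ne {b b' : S.Box} (h : b ≠ b') :
    (piece (.box b') : Diagram S _ _).boxCount b = 0 := by
  simp [boxCount, h]

theorem boxCount_subst_facingBalls {h₁ h₂ : ℕ} {foot : Fin h₁ → Word (Fin h₂)} (a : Fin h₁)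
    {V W : Word (Fin h₂)} (G : Diagram (facingSig foot) V W) :
    (G.subst (S := facingSig foot) (facingBalls foot)).boxCount (S := ballSig foot) (a, true) =
      G.boxCount (S := facingSig foot) a := by
  induction G with
  | id => rfl
  | comp f g hf hg => simp only [subst, boxCount, hf, hg]
  | tensor f g hf hg => simp only [subst, boxCount, hf, hg]
  | piece p =>
    cases p with
    | box b =>
      have h₂ : Diagram.boxCount (S := ballSig foot) (a, true)
          (.piece (.box (S := ballSig foot) (b, false))) = 0 :=
        boxCount_box_of_ne (S := ballSig foot) (fun h => Bool.noConfusion (congrArg Prod.snd h))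
      by_cases hab : a = b
      · subst hab
        exact (congrArg₂ (· + ·) (boxCount_box_self (S := ballSig foot) (a, true)) h₂).trans
          (boxCount_box_self (S := facingSig foot) a).symm
      · exact (congrArg₂ (· + ·) (boxCount_box_of_ne (S := ballSig foot)
          (fun h => hab (congrArg Prod.fst h))) h₂).trans
          (boxCount_box_of_ne (S := facingSig foot) hab).symm
    | _ => rfl

end Diagram

end BoxCount

/-! ### Evaluation after substituting boxes and renaming strands -/

section Replacement

variable {D : Type u₂} [Category.{v₂} D] [MonoidalCategory D] [LeftRigidCategory D]
  [BraidedCategory D] [PivotalCategory D] {ι ι' : Type}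

theorem Diagram.eval_subst {S S' : BoxSig ι} (X : ι → D)
    (φ : ∀ b, (S'.dom b).obj X ⟶ (S'.cod b).obj X) (ψ : ∀ b, Diagram S' (S.dom b) (S.cod b))
    {V W : Word ι} (f : Diagram S V W) :
    (f.subst ψ).eval X φ = f.eval X (fun b => (ψ b).eval X φ) := by
  induction f with
  | id => rfl
  | comp f g hf hg => exact congrArg₂ (· ≫ ·) hf hg
  | tensor f g hf hg => exact congrArg₂ (· ⊗ₘ ·) hf hg
  | piece p => cases p with
    | cap j b => cases b <;> rfl
    | cup j b => cases b <;> rfl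
    | _ => rfl

/-- The object of a relabelled row of points. -/
def Word.relabelIso (g : ι → ι') (X : ι' → D) :
    ∀ W : Word ι, (W.relabel g).obj X ≅ W.obj (fun j => X (g j))
  | .unit => Iso.refl _
  | .strand _ true => Iso.refl _
  | .strand _ false => Iso.refl _
  | .tensor V W => V.relabelIso g X ⊗ᵢ W.relabelIso g X

/-- For a general row the two objects agree only by induction on the row, so the evaluations are
compared through `Word.relabelIso`, in the form of a naturality square. -/
theorem Diagram.eval_relabel (g : ι → ι') {S : BoxSig ι} (X : ι' → D)
    (φ : ∀ b, (S.dom b).obj (fun j => X (g j)) ⟶ (S.cod b).obj (fun j => X (g j)))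
    (φ' : ∀ b, ((S.dom b).relabel g).obj X ⟶ ((S.cod b).relabel g).obj X)
    (hφ : ∀ b, φ' b ≫ ((S.cod b).relabelIso g X).hom = ((S.dom b).relabelIso g X).hom ≫ φ b)
    {V W : Word ι} (f : Diagram S V W) :
    (f.relabel g).eval (S := S.relabel g) X φ' ≫ (W.relabelIso g X).hom =
      (V.relabelIso g X).hom ≫ f.eval (fun j => X (g j)) φ := by
  induction f with
  | id => exact (Category.id_comp _).trans (Category.comp_id _).symm
  | comp f f' hf hf' =>
    simp only [relabel, eval, Category.assoc, hf', reassoc_of% hf]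
  | tensor f f' hf hf' =>
    change (_ ⊗ₘ _) ≫ (_ ⊗ₘ _) = (_ ⊗ₘ _) ≫ (_ ⊗ₘ _)
    rw [tensorHom_comp_tensorHom, tensorHom_comp_tensorHom, hf, hf']
  | piece p =>
    cases p with
    | box b => exact hφ b
    | cap j b =>
      cases b
      · change evL (X (g j)) ≫ 𝟙 _ = (𝟙 _ ⊗ₘ 𝟙 _) ≫ evL (X (g j))
        simp
      · change evR (X (g j)) ≫ 𝟙 _ = (𝟙 _ ⊗ₘ 𝟙 _) ≫ evR (X (g j))
        simp
    | cup j b =>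
      cases b
      · change coevR (X (g j)) ≫ (𝟙 _ ⊗ₘ 𝟙 _) = 𝟙 _ ≫ coevR (X (g j))
        simp
      · change coevL (X (g j)) ≫ (𝟙 _ ⊗ₘ 𝟙 _) = 𝟙 _ ≫ coevL (X (g j))
        simp
    | assoc U V W =>
      exact (associator_naturality (U.relabelIso g X).hom (V.relabelIso g X).hom
        (W.relabelIso g X).hom).symm
    | assocInv U V W =>
      exact (associator_inv_naturality (U.relabelIso g X).hom (V.relabelIso g X).hom
        (W.relabelIso g X).hom).symm
    | leftUnit V =>
      change (λ_ _).hom ≫ _ = (𝟙 _ ⊗ₘ _) ≫ (λ_ _).hom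
      rw [id_tensorHom, leftUnitor_naturality]
    | leftUnitInv V =>
      change (λ_ _).inv ≫ (𝟙 _ ⊗ₘ _) = _ ≫ (λ_ _).inv
      rw [id_tensorHom, leftUnitor_inv_naturality]
    | rightUnit V =>
      change (ρ_ _).hom ≫ _ = (_ ⊗ₘ 𝟙 _) ≫ (ρ_ _).hom
      rw [tensorHom_id, rightUnitor_naturality]
    | rightUnitInv V =>
      change (ρ_ _).inv ≫ (_ ⊗ₘ 𝟙 _) = _ ≫ (ρ_ _).inv
      rw [tensorHom_id, rightUnitor_inv_naturality]
    | braid V W =>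
      exact (BraidedCategory.braiding_naturality (V.relabelIso g X).hom
        (W.relabelIso g X).hom).symm
    | braidInv V W =>
      change (β_ _ _).inv ≫ (_ ⊗ₘ _) = (_ ⊗ₘ _) ≫ (β_ _ _).inv
      rw [Iso.inv_comp_eq, ← Category.assoc, Iso.eq_comp_inv,
        BraidedCategory.braiding_naturality]

theorem eval_encircled {S : BoxSig ι} (X : ι → D)
    (φ : ∀ b, (S.dom b).obj X ⟶ (S.cod b).obj X) (j : ι) (V : Word ι) :
    (encircled (S := S) j V).eval X φ = encirclement (X j) (V.obj X) := by
  change (ρ_ _).inv ≫ (𝟙 _ ⊗ₘ coevL (X j)) ≫ (α_ _ _ _).inv ≫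
    ((β_ (V.obj X) (X j)).hom ⊗ₘ 𝟙 _) ≫ ((β_ (X j) (V.obj X)).hom ⊗ₘ 𝟙 _) ≫ (α_ _ _ _).hom ≫
    (𝟙 _ ⊗ₘ evR (X j)) ≫ (ρ_ _).hom = _
  simp [encirclement, monodromy]

end Replacement

/-! ### Multilinearity in the boxes -/

section Multilinear

variable {D : Type u₂} [Category.{v₂} D] [Preadditive D] [Linear ℂ D]
  [MonoidalCategory D] [MonoidalPreadditive D] [MonoidalLinear ℂ D]
  [LeftRigidCategory D] [BraidedCategory D] [PivotalCategory D]
  {ι : Type} {S : BoxSig ι} (X : ι → D)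

theorem tensorHom_smul_add {U U' V V' : D} (f : U ⟶ U') (c : ℂ) (g g' : V ⟶ V') :
    f ⊗ₘ (c • g + g') = c • (f ⊗ₘ g) + (f ⊗ₘ g') := by
  simp [MonoidalCategory.tensorHom_def]

theorem smul_add_tensorHom {U U' V V' : D} (c : ℂ) (f f' : U ⟶ U') (g : V ⟶ V') :
    (c • f + f') ⊗ₘ g = c • (f ⊗ₘ g) + (f' ⊗ₘ g) := by
  simp [MonoidalCategory.tensorHom_def]

namespace Diagram

theorem eval_update_of_boxCount_eq_zero [DecidableEq S.Box]
    (φ : ∀ b, (S.dom b).obj X ⟶ (S.cod b).obj X) (b : S.Box)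
    (x : (S.dom b).obj X ⟶ (S.cod b).obj X) {V W : Word ι} (f : Diagram S V W)
    (hf : f.boxCount b = 0) :
    f.eval X (Function.update φ b x) = f.eval X φ := by
  induction f with
  | id => rfl
  | comp f g ihf ihg =>
    rw [boxCount, Nat.add_eq_zero_iff] at hf
    simp only [eval, ihf hf.1, ihg hf.2]
  | tensor f g ihf ihg =>
    rw [boxCount, Nat.add_eq_zero_iff] at hf
    exact congrArg₂ (· ⊗ₘ ·) (ihf hf.1) (ihg hf.2)
  | piece p => cases p with
    | cap j b => cases b <;> rfl
    | cup j b => cases b <;> rfl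
    | box b' =>
      have hne : b' ≠ b := by
        rintro rfl
        simp [boxCount] at hf
      exact Function.update_of_ne hne _ _
    | _ => rfl

/-- In a composite or tensor product exactly one factor contains the box; the other does not see the
update, and both operations are bilinear. -/
theorem eval_update_add_smul [DecidableEq S.Box]
    (φ : ∀ b, (S.dom b).obj X ⟶ (S.cod b).obj X) (b : S.Box) (c : ℂ)
    (x y : (S.dom b).obj X ⟶ (S.cod b).obj X) {V W : Word ι} (f : Diagram S V W)
    (hf : f.boxCount b = 1) :
    f.eval X (Function.update φ b (c • x + y)) =
      c • f.eval X (Function.update φ b x) + f.eval X (Function.update φ b y) := by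
  induction f with
  | id => simp [boxCount] at hf
  | comp f g ihf ihg =>
    rw [boxCount, Nat.add_eq_one_iff] at hf
    rcases hf with ⟨h0, h1⟩ | ⟨h1, h0⟩
    · simp only [eval, ihg h1, eval_update_of_boxCount_eq_zero X φ b _ f h0,
        Preadditive.comp_add, Linear.comp_smul]
    · simp only [eval, ihf h1, eval_update_of_boxCount_eq_zero X φ b _ g h0,
        Preadditive.add_comp, Linear.smul_comp]
  | tensor f g ihf ihg =>
    rw [boxCount, Nat.add_eq_one_iff] at hf
    rcases hf with ⟨h0, h1⟩ | ⟨h1, h0⟩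
    · have hf := eval_update_of_boxCount_eq_zero X φ b
      refine (congrArg₂ (· ⊗ₘ ·) (hf _ f h0) (ihg h1)).trans (Eq.trans ?_
        (congrArg₂ (fun p q => c • p + q) (congrArg₂ (· ⊗ₘ ·) (hf x f h0).symm rfl)
          (congrArg₂ (· ⊗ₘ ·) (hf y f h0).symm rfl)))
      exact tensorHom_smul_add _ c _ _
    · have hg := eval_update_of_boxCount_eq_zero X φ b
      refine (congrArg₂ (· ⊗ₘ ·) (ihf h1) (hg _ g h0)).trans (Eq.trans ?_
        (congrArg₂ (fun p q => c • p + q) (congrArg₂ (· ⊗ₘ ·) rfl (hg x g h0).symm)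
          (congrArg₂ (· ⊗ₘ ·) rfl (hg y g h0).symm)))
      exact smul_add_tensorHom c _ _ _
  | piece p => cases p with
    | box b' =>
      have hb : b = b' := by
        by_contra hne
        simp [boxCount, hne] at hf
      subst hb
      simp [eval, Piece.eval]
    | _ => simp [boxCount] at hf

/-- The evaluation of a diagram in which every box occurs once, as a multilinear map. -/
def evalMultilinear {V W : Word ι} (f : Diagram S V W) (hf : ∀ b, f.boxCount b = 1) :
    MultilinearMap ℂ (fun b => (S.dom b).obj X ⟶ (S.cod b).obj X) (V.obj X ⟶ W.obj X) where
  toFun φ := f.eval X φ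
  map_update_add' φ b x y := by
    have := f.eval_update_add_smul X φ b 1 x y (hf b)
    simpa using this
  map_update_smul' φ b c x := by
    -- With zero inserted twice this reads `v = v + v`, so a zero box gives value zero.
    have h0 := f.eval_update_add_smul X φ b 1 0 0 (hf b)
    have := f.eval_update_add_smul X φ b c x 0 (hf b)
    simp only [add_zero, one_smul, left_eq_add] at h0
    rwa [add_zero, h0, add_zero] at this

end Diagram

end Multilinear

/-! ### Comparison of the link evaluation with the state sum -/

section StateSum

variable {C : Type u₁} [Category.{v₁} C] [Preadditive C] [Linear ℂ C]
  [MonoidalCategory C] [MonoidalPreadditive C] [MonoidalLinear ℂ C]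
  [LeftRigidCategory C] [PivotalCategory C] [FusionCategory C]
  {D : Type u₂} [Category.{v₂} D] [Preadditive D] [Linear ℂ D]
  [MonoidalCategory D] [MonoidalPreadditive D] [MonoidalLinear ℂ D]
  [LeftRigidCategory D] [BraidedCategory D] [PivotalCategory D] [RibbonCategory D]
  [FusionCategory D]

theorem transparent_of_iso_unit {X : D} (e : 𝟙_ D ≅ X) : Transparent X := by
  intro Y
  change monodromy X Y = 𝟙 _
  rw [← cancel_epi (e.hom ▷ Y), monodromy_naturality_left]
  simp [monodromy]

/-- By modularity the representative of the unit is the only transparent label; it has dimension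
one, so only its multiplicity remains. -/
theorem dim_transparentPart_kirbyColourImage [IsModular D] (F : C ⥤ D) :
    (kirbyColourImage F).transparentPart.dim = unitMultiplicity F := by
  classical
  obtain ⟨Z₀, ⟨e⟩⟩ := exists_unit_iso (D := D)
  have ht : ∀ Z : Irr D, Transparent (simple Z) ↔ Z = Z₀ := fun Z =>
    ⟨fun h => FusionCategory.inequivalent _ _
      ((IsModular.iso_unit Z h).map fun i => i ≪≫ e),
      fun h => h ▸ transparent_of_iso_unit e⟩
  simp only [Colour.dim, Colour.transparentPart, ht, ite_mul, zero_mul, Finset.sum_ite_eq',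
    Finset.mem_univ, if_true]
  rw [← dim_congr e, dim_unit, mul_one, kirbyColourImage, unitMultiplicity, Finset.sum_apply]
  refine Finset.sum_congr rfl fun X _ => ?_
  rw [Pi.smul_apply, colourOf, smul_eq_mul,
    (Linear.homCongr ℂ (Iso.refl (F.obj (simple X))) e.symm).finrank_eq]

/-- Under a multilinear map, bundles of strands encircled by the Kirby colour can be replaced by
sums over dual bases. -/
theorem sum_prod_dim_smul_map_encirclement [IsModular D] {n : ℕ} {Y : Fin n → D} {T : Type*}
    [AddCommGroup T] [Module ℂ T]
    (M : MultilinearMap ℂ (fun a => Y a ⟶ Y a) T) (B : ∀ a, DualBases (Y a)) :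
    ∑ Z : Fin n → Irr D, (∏ a, dim (simple (Z a))) •
        M (fun a => encirclement (simple (Z a)) (Y a)) =
      globalDim D ^ n • ∑ s : ∀ a, Fin (B a).card,
        M (fun a => (B a).basis (s a) ≫ (B a).dual (s a)) := by
  classical
  -- Collecting the sum over all labellings by multilinearity puts one full Kirby circle into each
  -- argument, where the killing property applies.
  have h := M.map_sum (fun a (Z : Irr D) => dim (simple Z) • encirclement (simple Z) (Y a))
  simp only [MultilinearMap.map_smul_univ] at h
  rw [← h, ← M.map_sum (fun a (i : Fin (B a).card) => (B a).basis i ≫ (B a).dual i)]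
  have hk : (fun a => ∑ Z : Irr D, dim (simple Z) • encirclement (simple Z) (Y a)) =
      fun a => globalDim D • ∑ i, (B a).basis i ≫ (B a).dual i :=
    funext fun a => killing_eq_sum (B a)
  rw [hk, MultilinearMap.map_smul_univ, Finset.prod_const, Finset.card_univ, Fintype.card_fin]

variable {F : C ⥤ D} {h₁ h₂ : ℕ} {K : KirbyDiagram h₁ h₂} {L : DottedLink h₁ h₂}

open KirbyDiagram

/-- Each coupon of `G` contributes one `+`-ball, and the number of `+`-balls is the same as in `K`.
-/
theorem KirbyDiagram.boxCount_eq_one (K : KirbyDiagram h₁ h₂)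
    {G : ClosedDiagram (facingSig K.foot)}
    (hG : Diagram.Isotopic K.diagram (G.subst (S := facingSig K.foot) (facingBalls K.foot)))
    (a : Fin h₁) : G.boxCount (S := facingSig K.foot) a = 1 := by
  exact (Diagram.boxCount_subst_facingBalls a G).symm.trans
    ((hG.boxCount_eq (a, true)).symm.trans (K.ball_once (a, true)))

theorem eval_kirbyDiagram (B : K.BasisChoice F) (X : Fin h₂ → Irr C) (s : MorphismLabelling B X)
    {G : ClosedDiagram (facingSig K.foot)}
    (hG : Diagram.Isotopic K.diagram (G.subst (S := facingSig K.foot) (facingBalls K.foot))) :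
    K.diagram.eval (objects F X) (ballMorphism B X s) =
      G.eval (S := facingSig K.foot) (objects F X)
        (fun a => (B X a).basis (s a) ≫ (B X a).dual (s a)) := by
  exact (Diagram.Isotopic.eval_eq _ _ hG).trans
    (Diagram.eval_subst (S := facingSig K.foot) _ _ _ G)

theorem eval_dottedLink (X : Fin h₂ → Irr C) (Z : Fin h₁ → Irr D)
    {G : ClosedDiagram (facingSig K.foot)}
    (hG : Diagram.Isotopic L.diagram
      ((G.relabel (Sum.inr : Fin h₂ → Fin h₁ ⊕ Fin h₂)).subst
        (S := (facingSig K.foot).relabel Sum.inr)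
        (fun a => encircled (Sum.inl a) ((K.foot a).relabel Sum.inr)))) :
    L.diagram.eval (Sum.elim (fun a => simple (Z a)) (fun j => F.obj (simple (X j))))
        (fun b : Empty => b.elim) =
      G.eval (S := facingSig K.foot) (objects F X)
        (fun a => encirclement (simple (Z a)) ((K.foot a).obj (objects F X))) := by
  refine (Diagram.Isotopic.eval_eq _ _ hG).trans
    ((Diagram.eval_subst (S := (facingSig K.foot).relabel Sum.inr) _ _ _ _).trans ?_)
  refine (congrArg (fun ψ => Diagram.eval (S := (facingSig K.foot).relabel Sum.inr)
      (Sum.elim (fun a => simple (Z a)) (fun j => F.obj (simple (X j)))) ψ (G.relabel Sum.inr))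
    (funext fun a => eval_encircled (S := noBox (Fin h₁ ⊕ Fin h₂))
      (Sum.elim (fun a => simple (Z a)) (fun j => F.obj (simple (X j)))) (fun b : Empty => b.elim)
      (Sum.inl a) ((K.foot a).relabel Sum.inr))).trans ?_
  have h := Diagram.eval_relabel (S := facingSig K.foot) (Sum.inr : Fin h₂ → Fin h₁ ⊕ Fin h₂)
    (Sum.elim (fun a => simple (Z a)) (fun j => F.obj (simple (X j))))
    (fun a => encirclement (simple (Z a)) ((K.foot a).obj (objects F X)))
    (fun a => encirclement (simple (Z a)) (((K.foot a).relabel Sum.inr).obj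
      (Sum.elim (fun a => simple (Z a)) (fun j => F.obj (simple (X j))))))
    (fun a => (encirclement_naturality (simple (Z a)) _).symm) G
  -- The diagram is closed, so the relabelling isomorphisms at both ends are identities.
  exact (Category.comp_id _).symm.trans (h.trans (Category.id_comp _))

theorem evaluation_eq_globalDim_pow_mul [IsModular D] (hL : K.HasDottedForm L)
    (B : K.BasisChoice F) :
    L.evaluation F = globalDim D ^ h₁ * KirbyDiagram.evaluation B := by
  obtain ⟨G, hK, hG⟩ := hL
  have hM (X : Fin h₂ → Irr C) :
      ∑ Z : Fin h₁ → Irr D, (∏ a, dim (simple (Z a))) * scalar (G.eval (S := facingSig K.foot)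
        (objects F X) (fun a => encirclement (simple (Z a)) ((K.foot a).obj (objects F X)))) =
      globalDim D ^ h₁ * ∑ s : MorphismLabelling B X, scalar (G.eval (S := facingSig K.foot)
        (objects F X) (fun a => (B X a).basis (s a) ≫ (B X a).dual (s a))) := by
    exact sum_prod_dim_smul_map_encirclement ((scalarₗ D).compMultilinearMap
      (Diagram.evalMultilinear (S := facingSig K.foot) (objects F X) G (K.boxCount_eq_one hK)))
      (B X)
  rw [DottedLink.evaluation, KirbyDiagram.evaluation, Finset.sum_comm, Finset.mul_sum]
  refine Finset.sum_congr rfl fun X _ => ?_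
  rw [← Finset.mul_sum, mul_left_comm]
  simp only [eval_kirbyDiagram B X _ hK, eval_dottedLink X _ hG]
  refine Eq.trans ?_ (congrArg (fun c => (∏ j, dim (simple (X j))) * c) (hM X))
  rw [Finset.mul_sum]
  refine Finset.sum_congr rfl fun Z _ => ?_
  rw [mul_comm (∏ a, dim (simple (Z a))), mul_assoc]

end StateSum

end Dichromatic

end

theorem mainTheorem10
    {C : Type u₁} [Category.{v₁} C] [Preadditive C] [Linear ℂ C]
    [MonoidalCategory C] [MonoidalPreadditive C] [MonoidalLinear ℂ C]
    [LeftRigidCategory C] [Dichromatic.PivotalCategory C] [Dichromatic.SphericalCategory C]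
    [Dichromatic.FusionCategory C]
    {D : Type u₂} [Category.{v₂} D] [Preadditive D] [Linear ℂ D]
    [MonoidalCategory D] [MonoidalPreadditive D] [MonoidalLinear ℂ D]
    [LeftRigidCategory D] [BraidedCategory D] [Dichromatic.PivotalCategory D]
    [Dichromatic.RibbonCategory D] [Dichromatic.FusionCategory D] [Dichromatic.IsModular D]
    (F : C ⥤ D) [F.Additive] [F.Linear ℂ] [F.Monoidal] [Dichromatic.IsPivotalFunctor F]
    {h₁ h₂ : ℕ} (K : Dichromatic.KirbyDiagram h₁ h₂) (B : K.BasisChoice F)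
    (L : Dichromatic.DottedLink h₁ h₂) (hL : K.HasDottedForm L) :
    Dichromatic.dichromaticInvariant F L =
      Dichromatic.KirbyDiagram.evaluation B /
        (Dichromatic.globalDim C ^ ((h₂ : ℤ) - (h₁ : ℤ)) *
          Dichromatic.unitMultiplicity F ^ h₁) := by
  -- Only the power of `globalDim D` is cancelled. The factors from `C` and the unit multiplicity
  -- stand in both denominators, so their nonvanishing plays no role.
  rw [Dichromatic.dichromaticInvariant, Dichromatic.evaluation_eq_globalDim_pow_mul hL B,
    Dichromatic.dim_transparentPart_kirbyColourImage, mul_pow, mul_left_comm,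
    mul_div_mul_left _ _ (pow_ne_zero _ Dichromatic.globalDim_ne_zero)]
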